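/- Let $n\ge 1$. Let $\mathcal{O}_{\min}\subset\mathfrak{sl}_{n+1}(\mathbb{C})$ be the minimal nonzero nilpotent adjoint orbit, i.e. the orbit of the elementary matrix $E_{1,n+1}$ under conjugation by $SL_{n+1}(\mathbb{C})$ (equivalently, the set of traceless matrices of rank one). Let $\overline{\mathcal{O}}_{\min}=\mathcal{O}_{\min}\cup\{0\}$ be its closure with its reduced scheme structure, and let $\mathfrak{n}^+$ be the space of strictly upper triangular $(n+1)\times(n+1)$ matrices. Let $\mathbb{C}[\mathfrak{n}^+]=\mathbb{C}[x_{ij}: 1\le i<j\le n+1]$, and let $I\subset\mathbb{C}[\mathfrak{n}^+]$ be the ideal of the scheme-theoretic intersection $\overline{\mathcal{O}}_{\min}\cap\mathfrak{n}^+$, i.e. the ideal consisting of the restrictions to $\mathfrak{n}^+$ of all polynomial functions on matrices that vanish on $\overline{\mathcal{O}}_{\min}$. Then the following hold. 1. The scheme-theoretic intersection $\overline{\mathcal{O}}_{\min}\cap\mathfrak{n}^+=\operatorname{Spec}\mathbb{C}[\mathfrak{n}^+]/I$ is reduced. 2. It is Cohen–Macaulay, i.e. $\mathbb{C}[\mathfrak{n}^+]/I$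 is Noetherian, and each of its localizations at maximal ideals is a local ring whose depth equals its Krull dimension. 3. Number the variables so that $x_{ij}$ has number $(2n-j+i+2)(j-i-1)/2+i$, and use the degree reverse lexicographic order with $x_1>x_2>\dots>x_{n(n+1)/2}$: $\prod x_k^{a_k}>\prod x_k^{b_k}$ if $\sum a_k>\sum b_k$, or if $\sum a_k=\sum b_k$ and the last nonzero entry of $(a_k-b_k)_k$ is negative. Let $\Delta'$ be the order complex of the set of pairs $(i,j)$, $1\le i<j\le n+1$, partially ordered by inclusion of the intervals $[i,j]$; its faces are the chains, including the empty one. Then the initial ideal of $I$ (generated by the largest monomials of the nonzero elements of $I$) is the Stanley–Reisner ideal of $\Delta'$, i.e. the ideal generated by the monomials $\prod_{(i,j)\in S}x_{ij}$ for the sets $S$ that are not faces of $\Delta'$. 4. The complex $\Delta'$ is pure, and its maximal faces are exactly the vertex sets of the lattice paths from some $(i,i+1)$, $1\le i\le n$, to $(1,n+1)$ in which every step is north, $(a,b)\to(a-1,b)$, or east, $(a,b)\to(a,b+1)$. It is shellable, and the following order on these paths is a shelling. A path from $(i,i+1)$ precedes every path from $(j,j+1)$ if $i<j$; of two different paths with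 the same start, the one that goes north at the first step where they differ precedes the other, which goes east there. That is, for each path $P$ but the first, the faces of $P$ that are contained in some preceding path are exactly the subsets of the sets $P\setminus\{v\}$, $v\in A$, for some nonempty set $A$ of vertices of $P$. -/

import Mathlib

noncomputable section

/-! ### Cohen–Macaulay rings -/

/-- A Noetherian local ring is Cohen–Macaulay if its depth equals its Krull dimension, that is, if
its maximal ideal contains a regular sequence whose length is the Krull dimension. -/
def IsCohenMacaulayLocalRing (R : Type*) [CommRing R] [IsLocalRing R] : Prop :=
  IsNoetherianRing R ∧
    ∃ rs : List R, (∀ r ∈ rs, r ∈ IsLocalRing.maximalIdeal R) ∧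
      RingTheory.Sequence.IsRegular R rs ∧ (rs.length : WithBot ℕ∞) = ringKrullDim R

/-- A Noetherian ring is Cohen–Macaulay if its localizations at all maximal ideals are. -/
def IsCohenMacaulayRing (R : Type*) [CommRing R] : Prop :=
  IsNoetherianRing R ∧
    ∀ (m : Ideal R) [m.IsMaximal], IsCohenMacaulayLocalRing (Localization.AtPrime m)

/-! ### The scheme-theoretic intersection -/

/-- The minimal nonzero nilpotent adjoint orbit of `𝔰𝔩ₙ₊₁(ℂ)` (for `n ≥ 1`): the adjoint orbit of
the highest root vector `E_{1,n+1}` under `SLₙ₊₁(ℂ)`. -/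
def minNilpotentOrbit (n : ℕ) : Set (Matrix (Fin (n + 1)) (Fin (n + 1)) ℂ) :=
  {A | ∃ g : Matrix.SpecialLinearGroup (Fin (n + 1)) ℂ,
    A = (g : Matrix (Fin (n + 1)) (Fin (n + 1)) ℂ) * Matrix.single 0 (Fin.last n) 1 *
      ((g⁻¹ : Matrix.SpecialLinearGroup (Fin (n + 1)) ℂ) : Matrix (Fin (n + 1)) (Fin (n + 1)) ℂ)}

/-- The ideal, in the coordinate ring of all `(n+1) × (n+1)` matrices, of the closed subvariety
`closure O_min`. -/
def minOrbitClosureIdeal (n : ℕ) : Ideal (MvPolynomial (Fin (n + 1) × Fin (n + 1)) ℂ) :=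
  MvPolynomial.vanishingIdeal ℂ
    {x : Fin (n + 1) × Fin (n + 1) → ℂ |
      Matrix.of (fun i j => x (i, j)) ∈ closure (minNilpotentOrbit n)}

/-- Positions `(i, j)`, `i < j`, strictly above the diagonal (rows and columns are numbered from
`0`). They index the coordinates on `𝔫⁺`, and each of them stands for the interval `[i, j]`. -/
abbrev UpperPos (n : ℕ) : Type := {p : Fin (n + 1) × Fin (n + 1) // p.1 < p.2}

/-- Restriction of polynomial functions from all matrices to the strictly upper triangular
matrices `𝔫⁺`; the target is the coordinate ring of `𝔫⁺`. -/
def restrictToUpper (n : ℕ) :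
    MvPolynomial (Fin (n + 1) × Fin (n + 1)) ℂ →ₐ[ℂ] MvPolynomial (UpperPos n) ℂ :=
  MvPolynomial.aeval fun p => if h : p.1 < p.2 then MvPolynomial.X ⟨p, h⟩ else 0

/-- The ideal of the scheme-theoretic intersection `closure O_min ∩ 𝔫⁺` in the coordinate ring of
`𝔫⁺`. As `restrictToUpper n` is surjective and its kernel is the ideal of `𝔫⁺`, the quotient by it
is the quotient of the coordinate ring of all matrices by the sum of the ideals of `closure O_min`
and of `𝔫⁺`. -/
def intersectionIdeal (n : ℕ) : Ideal (MvPolynomial (UpperPos n) ℂ) :=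
  (minOrbitClosureIdeal n).map (restrictToUpper n)

/-- The coordinate ring of the affine scheme `closure O_min ∩ 𝔫⁺`. -/
abbrev IntersectionRing (n : ℕ) : Type := MvPolynomial (UpperPos n) ℂ ⧸ intersectionIdeal n

/-! ### Initial ideals for the degree reverse lexicographic order -/

/-- `a > b` in the degree reverse lexicographic order on exponents, where the variables are ordered
by the (injective) numbering `label`, a smaller number meaning a larger variable: the degree of
`a` is larger, or the degrees agree and the last nonzero entry of `a - b` is negative. -/
def DegRevLexGT {σ : Type*} (label : σ → ℕ) (a b : σ →₀ ℕ) : Prop :=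
  b.degree < a.degree ∨
    (a.degree = b.degree ∧ ∃ s, a s < b s ∧ ∀ t, label s < label t → a t = b t)

/-- `a` is the exponent of the initial monomial of the nonzero polynomial `f`. -/
def IsInitialExponent {σ : Type*} (label : σ → ℕ) (f : MvPolynomial σ ℂ) (a : σ →₀ ℕ) : Prop :=
  a ∈ f.support ∧ ∀ b ∈ f.support, b ≠ a → DegRevLexGT label a b

/-- The initial ideal: it is generated by the initial monomials of the nonzero elements of `I`. -/
def initialIdeal {σ : Type*} (label : σ → ℕ) (I : Ideal (MvPolynomial σ ℂ)) :
    Ideal (MvPolynomial σ ℂ) :=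
  Ideal.span {m | ∃ f ∈ I, ∃ a, IsInitialExponent label f a ∧ m = MvPolynomial.monomial a 1}

/-- The numbering of the coordinates on `𝔫⁺` by `1, …, n(n+1)/2`, superdiagonal by superdiagonal,
starting next to the main diagonal, and from northwest to southeast on each. For the 1-based
position `(i, j)` the number is `(2n - j + i + 2)(j - i - 1)/2 + i`. -/
def upperLabel (n : ℕ) (p : UpperPos n) : ℕ :=
  (2 * n + 2 - ((p.1.2 : ℕ) - (p.1.1 : ℕ))) * ((p.1.2 : ℕ) - (p.1.1 : ℕ) - 1) / 2 + (p.1.1 : ℕ) + 1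

/-! ### Simplicial complexes

A simplicial complex on the vertex set `σ` is a set of finite subsets (its faces, the empty face
included) that is closed under passing to subsets. -/

/-- The Stanley–Reisner ideal: it is generated by the squarefree monomials of the non-faces. -/
def stanleyReisnerIdeal {σ : Type*} (Δ : LowerSet (Finset σ)) : Ideal (MvPolynomial σ ℂ) :=
  Ideal.span {m | ∃ S : Finset σ, S ∉ Δ ∧ m = ∏ s ∈ S, MvPolynomial.X s}

/-- A facet is a maximal face. -/
def IsFacet {σ : Type*} (Δ : LowerSet (Finset σ)) (F : Finset σ) : Prop :=
  Maximal (fun S => S ∈ Δ) F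

/-- The list `L` is a shelling of `Δ`: `Δ` is pure, `L` enumerates its facets without repetition,
and, for each facet `L[k]` other than the first, its intersection with the subcomplex generated by
the earlier facets is the subcomplex generated by a nonempty set of maximal proper faces
`L[k] \ {v}`, `v ∈ A`, of `L[k]`. -/
def IsShelling {σ : Type*} [DecidableEq σ] (Δ : LowerSet (Finset σ)) (L : List (Finset σ)) : Prop :=
  (∀ F G, IsFacet Δ F → IsFacet Δ G → F.card = G.card) ∧
    L.Nodup ∧ (∀ F, F ∈ L ↔ IsFacet Δ F) ∧
    ∀ (k : ℕ) (hk : k < L.length), 0 < k →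
      ∃ A : Finset σ, A.Nonempty ∧ A ⊆ L[k] ∧
        ∀ G : Finset σ, (G ⊆ L[k] ∧ ∃ F ∈ L.take k, G ⊆ F) ↔ ∃ v ∈ A, G ⊆ L[k].erase v

/-- The order of the intervals `[i, j]` by inclusion. -/
def IntervalLE {n : ℕ} (p q : UpperPos n) : Prop :=
  Set.Icc p.1.1 p.1.2 ⊆ Set.Icc q.1.1 q.1.2

/-- The order complex of the poset of intervals: its faces are the finite chains. -/
def intervalComplex (n : ℕ) : LowerSet (Finset (UpperPos n)) where
  carrier := {S | IsChain IntervalLE (S : Set (UpperPos n))}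
  lower' := fun _ _ hTS hS => IsChain.mono (Finset.coe_subset.2 hTS) hS

/-! ### Lattice paths and their order -/

/-- A step to the north, from `(i, j)` to `(i - 1, j)`. -/
def NorthStep {n : ℕ} (p q : UpperPos n) : Prop :=
  (q.1.1 : ℕ) + 1 = p.1.1 ∧ q.1.2 = p.1.2

/-- A step to the east, from `(i, j)` to `(i, j + 1)`. -/
def EastStep {n : ℕ} (p q : UpperPos n) : Prop :=
  q.1.1 = p.1.1 ∧ (q.1.2 : ℕ) = p.1.2 + 1

/-- Paths from some `(i, i + 1)` to the northeast corner by steps to the north and to the east,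
given as the lists of the positions they visit. -/
def IsLatticePath {n : ℕ} (P : List (UpperPos n)) : Prop :=
  (∃ p ∈ P.head?, (p.1.2 : ℕ) = p.1.1 + 1) ∧
    (∃ p ∈ P.getLast?, p.1 = (0, Fin.last n)) ∧
    P.IsChain fun p q => NorthStep p q ∨ EastStep p q

/-- `P` precedes `Q`: the start `(i, i + 1)` of `P` and the start `(j, j + 1)` of `Q` satisfy
`i < j`, or the two paths agree up to some position, from which `P` goes north and `Q` east. -/
def PathPrecedes {n : ℕ} (P Q : List (UpperPos n)) : Prop :=
  (∃ p ∈ P.head?, ∃ q ∈ Q.head?, p.1.1 < q.1.1) ∨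
    ∃ (l : List (UpperPos n)) (v p q : UpperPos n) (P' Q' : List (UpperPos n)),
      P = l ++ v :: p :: P' ∧ Q = l ++ v :: q :: Q' ∧ NorthStep v p ∧ EastStep v q

end

/-! Call a monomial standard if its intervals form a chain. The 2 × 2 minors vanish on rank-one
matrices, so modulo `I` the product of two crossing intervals equals the product of their hull and
overlap, or 0 if they meet in at most an endpoint. The exchange keeps the total length and raises
the sum of squared lengths, so modulo `I` every monomial is 0 or standard
(`straightens_intersectionIdeal`).

Conversely, if `u` is supported on the places up to `c` and `v` on those after `c`, then `u vᵀ` is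
strictly upper triangular, and in the orbit generically. So `I` is killed by the maps `rankOneHom n
c`, `c < n`, which send `x_ij` to `u_i v_j` or 0. Each standard monomial survives under one of them
and is determined by its row and column degrees (`eq_of_margin_eq`). Hence the standard monomials
are a basis of the quotient, and `I` is the intersection of kernels of maps to domains, so radical.
No monomial with the same row and column degrees is smaller than a standard one
(`not_degRevLexGT_of_margin_eq`), so initial monomials of `I` are nonstandard; the minors supply the
other inclusion.

The shelling rests on an exchange: an east-north corner of a path is replaced by a north-east one
(`PathPrecedes.exists_exchange`). It partitions the complex into intervals of faces. By
triangularity of the straightening, the quotient is then free over the polynomial ring in the rank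
sums (the sums of all `x_ij` of a given length), with basis the monomials of the minimal faces of
these intervals. A ring that is finite and flat over a polynomial ring over an algebraically closed
field is Cohen–Macaulay. -/

/-! ### Finite flat algebras over polynomial rings are Cohen–Macaulay -/

namespace MvPolynomial

variable {k : Type*} [Field k]

/-- The substitution of the values `a i`, `i < r`, for the first `r` variables. -/
noncomputable def evalFirst {n : ℕ} (a : Fin n → k) (r : ℕ) :
    MvPolynomial (Fin n) k →ₐ[k] MvPolynomial (Fin n) k :=
  aeval fun i => if (i : ℕ) < r then C (a i) else X i

/-- The list of the polynomials `X i - a i`. -/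
noncomputable def pointSequence {n : ℕ} (a : Fin n → k) : List (MvPolynomial (Fin n) k) :=
  List.ofFn fun i => X i - C (a i)

/-- Modulo the first `r` elements of the sequence, every polynomial is congruent to its partial
evaluation. The quotient thus embeds in a domain, which makes the sequence weakly regular. -/
theorem mem_ofList_take_pointSequence {n : ℕ} (a : Fin n → k) (r : ℕ) (f : MvPolynomial (Fin n) k) :
    f ∈ Ideal.ofList ((pointSequence a).take r) ↔ evalFirst a r f = 0 := by
  have hsub : ∀ g, g - evalFirst a r g ∈ Ideal.ofList ((pointSequence a).take r) := by
    intro g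
    have : (Ideal.Quotient.mkₐ k (Ideal.ofList ((pointSequence a).take r))) =
        (Ideal.Quotient.mkₐ k (Ideal.ofList ((pointSequence a).take r))).comp (evalFirst a r) := by
      ext i
      simp only [evalFirst, AlgHom.comp_apply, aeval_X, Ideal.Quotient.mkₐ_eq_mk]
      split_ifs with h
      · rw [Ideal.Quotient.eq]
        apply Ideal.subset_span
        simp only [Set.mem_ofPred_eq, List.mem_take_iff_getElem]
        refine ⟨i, ?_, ?_⟩
        · simp [pointSequence, h]
        · simp [pointSequence]
      · rfl
    have := congrArg (fun φ => φ g) this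
    simpa [Ideal.Quotient.eq] using this
  constructor
  · intro hf
    have : Ideal.ofList ((pointSequence a).take r) ≤ RingHom.ker (evalFirst a r) := by
      refine Ideal.span_le.2 fun g hg => ?_
      simp only [Set.mem_ofPred_eq, List.mem_take_iff_getElem] at hg
      obtain ⟨i, hi, rfl⟩ := hg
      simp only [pointSequence, List.length_ofFn, lt_inf_iff] at hi
      simp [pointSequence, evalFirst, hi.1, RingHom.mem_ker]
    exact this hf
  · intro hf
    simpa [hf] using hsub f

theorem isWeaklyRegular_pointSequence {n : ℕ} (a : Fin n → k) :
    RingTheory.Sequence.IsWeaklyRegular (MvPolynomial (Fin n) k) (pointSequence a) := by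
  refine ⟨fun i h => ?_⟩
  have hi : i < n := by simpa [pointSequence] using h
  rw [isSMulRegular_iff_right_eq_zero_of_smul]
  intro x
  obtain ⟨f, rfl⟩ := Submodule.Quotient.mk_surjective _ x
  rw [← Submodule.Quotient.mk_smul, Submodule.Quotient.mk_eq_zero, Submodule.Quotient.mk_eq_zero]
  have hget : (pointSequence a)[i] = X ⟨i, hi⟩ - C (a ⟨i, hi⟩) := by simp [pointSequence]
  rw [hget]
  simp only [smul_eq_mul, Ideal.mul_top, mem_ofList_take_pointSequence, map_mul]
  intro h
  refine (mul_eq_zero.1 h).resolve_left ?_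
  have : evalFirst a i (X ⟨i, hi⟩ - C (a ⟨i, hi⟩)) = X ⟨i, hi⟩ - C (a ⟨i, hi⟩) := by
    simp [evalFirst]
  rw [this]
  intro h0
  have := congrArg (eval (fun _ => a ⟨i, hi⟩ + 1)) h0
  simp at this

end MvPolynomial

/-- Incomparability: contraction of primes along an integral extension is strictly monotone. -/
theorem ringKrullDim_le_of_algebraIsIntegral (A B : Type*) [CommRing A] [CommRing B] [Algebra A B]
    [Algebra.IsIntegral A B] : ringKrullDim B ≤ ringKrullDim A :=
  Order.krullDim_le_of_strictMono (PrimeSpectrum.comap (algebraMap A B))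
    fun p _ h => Ideal.IsIntegral.comap_lt_comap (I := p.asIdeal) h

/-- By the Nullstellensatz a maximal ideal of `B` lies over a point `a`. The sequence `X i - a i`
stays regular under flat base change and localization, and its length `n` bounds the dimension of
`B` because `B` is integral over the polynomial ring. -/
theorem isCohenMacaulayRing_of_finite_of_flat {k : Type*} [Field k] [IsAlgClosed k] {n : ℕ} (B : Type*)
    [CommRing B] [Algebra (MvPolynomial (Fin n) k) B] [Module.Finite (MvPolynomial (Fin n) k) B]
    [Module.Flat (MvPolynomial (Fin n) k) B] : IsCohenMacaulayRing B := by
  have hN : IsNoetherianRing B := IsNoetherianRing.of_finite (MvPolynomial (Fin n) k) B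
  refine ⟨hN, fun m hm => ⟨inferInstance, ?_⟩⟩
  have hp : (m.comap (algebraMap (MvPolynomial (Fin n) k) B)).IsMaximal :=
    Ideal.isMaximal_comap_of_isIntegral_of_isMaximal m
  obtain ⟨a, ha⟩ := MvPolynomial.isMaximal_iff_eq_vanishingIdeal_singleton.1 hp
  have hreg := (MvPolynomial.isWeaklyRegular_pointSequence a).of_flat (S := B)
  have hmem : ∀ r ∈ (MvPolynomial.pointSequence a).map (algebraMap (MvPolynomial (Fin n) k) B),
      r ∈ m := by
    intro r hr
    obtain ⟨s, hs, rfl⟩ := List.mem_map.1 hr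
    rw [← Ideal.mem_comap, ha, MvPolynomial.mem_vanishingIdeal_singleton_iff]
    obtain ⟨i, rfl⟩ := List.mem_ofFn.1 hs
    simp
  have hreg' := hreg.isRegular_of_isLocalization_of_mem (S := Localization.AtPrime m) m hmem
  refine ⟨_, ?_, hreg', ?_⟩
  · intro r hr
    obtain ⟨s, hs, rfl⟩ := List.mem_map.1 hr
    exact (IsLocalization.AtPrime.to_map_mem_maximal_iff _ m s).2 (hmem s hs)
  · have h1 := ringKrullDim_add_length_eq_ringKrullDim_of_isRegular _ hreg'
    apply le_antisymm
    · rw [← h1]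
      have := Ideal.Quotient.nontrivial_iff.2 fun h => hreg'.2 (by rw [smul_eq_mul, Ideal.mul_top]; exact h.symm)
      exact le_add_of_nonneg_left ringKrullDim_nonneg_of_nontrivial
    · have h2 : ringKrullDim (Localization.AtPrime m) ≤ ringKrullDim B :=
        Order.krullDim_le_of_strictMono _
          (Monotone.strictMono_of_injective (fun _ _ h => Ideal.comap_mono h)
            (PrimeSpectrum.localization_comap_injective (Localization.AtPrime m) m.primeCompl))
      have h3 := ringKrullDim_le_of_algebraIsIntegral (MvPolynomial (Fin n) k) B
      rw [MvPolynomial.ringKrullDim_of_isNoetherianRing, ringKrullDim_eq_zero_of_field] at h3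
      simpa [MvPolynomial.pointSequence] using h2.trans h3

/-! ### Unitriangular change of basis, and freeness from a basis of products -/

theorem LinearIndependent.and_span_of_triangular {ι W K V : Type*} [Field K] [AddCommGroup V]
    [Module K V] [LinearOrder W] [WellFoundedLT W] (e : Module.Basis ι K V) (f : ι → V) (key : ι → W)
    (h : ∀ i, f i - e i ∈ Submodule.span K (e '' {j | key j < key i})) :
    LinearIndependent K f ∧ ⊤ ≤ Submodule.span K (Set.range f) := by
  constructor
  · have hc : ∀ i j, ¬ key j < key i → e.repr (f i) j = e.repr (e i) j := by
      intro i j hj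
      have : ∀ x ∈ Submodule.span K (e '' {j | key j < key i}), e.repr x j = 0 := by
        intro x hx
        induction hx using Submodule.span_induction with
        | mem x hx =>
          obtain ⟨l, hl, rfl⟩ := hx
          have : l ≠ j := fun h => hj (h ▸ hl)
          simp [this]
        | zero => simp
        | add x y _ _ hx hy => simp [hx, hy]
        | smul c x _ hx => simp [hx]
      have := this _ (h i)
      rw [map_sub, Finsupp.sub_apply, sub_eq_zero] at this
      exact this
    rw [linearIndependent_iff]
    intro l hl
    by_contra hne
    obtain ⟨i, hi, hmax⟩ := Finset.exists_max_image l.support key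
      (Finsupp.support_nonempty_iff.2 hne)
    have h0 : e.repr (Finsupp.linearCombination K f l) i = 0 := by rw [hl]; simp
    rw [Finsupp.linearCombination_apply, Finsupp.sum, map_sum, Finsupp.finsetSum_apply,
      Finset.sum_eq_single i] at h0
    · rw [map_smul, Finsupp.smul_apply, hc i i (lt_irrefl _)] at h0
      simp at h0
      simp [h0] at hi
    · intro j hj hji
      rw [map_smul, Finsupp.smul_apply, hc j i (not_lt.2 (hmax j hj))]
      simp [hji]
    · exact fun h => absurd hi h
  · rw [← e.span_eq, Submodule.span_le]
    rintro _ ⟨i, rfl⟩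
    induction hi : key i using WellFoundedLT.induction generalizing i with
    | ind x ih =>
      have : e i = f i - (f i - e i) := by abel
      rw [this]
      refine Submodule.sub_mem _ (Submodule.subset_span ⟨i, rfl⟩) ?_
      refine (Submodule.span_le.2 ?_) (h i)
      rintro _ ⟨j, hj, rfl⟩
      exact ih (key j) (hi ▸ hj) j rfl

/-- The `A`-linear map from the free module on `κ` sends a `K`-basis to a `K`-basis, so it is
bijective. -/
theorem Module.free_and_finite_of_smul_basis {K A B ι κ : Type*} [Field K] [CommRing A] [Algebra K A]
    [CommRing B] [Algebra A B] [Algebra K B] [IsScalarTower K A B] [Finite κ] (b : Module.Basis ι K A)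
    (η : κ → B) (hli : LinearIndependent K fun p : κ × ι => b p.2 • η p.1)
    (hsp : ⊤ ≤ Submodule.span K (Set.range fun p : κ × ι => b p.2 • η p.1)) :
    Module.Free A B ∧ Module.Finite A B := by
  let Ψ : (κ →₀ A) →ₗ[A] B := Finsupp.linearCombination A η
  let b₁ : Module.Basis ((_ : κ) × ι) K (κ →₀ A) := Finsupp.basis fun _ => b
  let b₂ := (Module.Basis.mk hli hsp).reindex (Equiv.sigmaEquivProd κ ι).symm
  have hΨ : Ψ.restrictScalars K = (b₁.equiv b₂ (Equiv.refl _)).toLinearMap := by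
    refine b₁.ext fun p => ?_
    rw [LinearEquiv.coe_coe, Module.Basis.equiv_apply]
    simp [b₁, b₂, Ψ]
  have hbij : Function.Bijective Ψ := by
    have : ⇑Ψ = b₁.equiv b₂ (Equiv.refl _) := congrArg DFunLike.coe hΨ
    rw [this]
    exact LinearEquiv.bijective _
  let E := LinearEquiv.ofBijective Ψ hbij
  exact ⟨Module.Free.of_equiv E, Module.Finite.equiv E⟩

/-! ### Partitioned complexes and freeness over the rank sums -/

/-- A partition of a complex `Δ` into intervals `[bot k, top k]`, such that `bot k` lies in no `top j`
with `j < k`, and in which the sets `top k` contain exactly one vertex of each of the ranks `Fin n`. -/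
structure RankedPartition {σ : Type*} [DecidableEq σ] (Δ : LowerSet (Finset σ)) {n : ℕ} (ρ : σ → Fin n) (ℓ : ℕ)
    where
  bot : Fin ℓ → Finset σ
  top : Fin ℓ → Finset σ
  vertex : Fin ℓ → Fin n → σ
  top_mem : ∀ k, top k ∈ Δ
  bot_subset : ∀ k, bot k ⊆ top k
  le_of_subset : ∀ j k, bot k ⊆ top j → k ≤ j
  exists_mem : ∀ S ∈ Δ, ∃ k, bot k ⊆ S ∧ S ⊆ top k
  vertex_mem : ∀ k r, vertex k r ∈ top k
  rank_vertex : ∀ k r, ρ (vertex k r) = r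
  vertex_rank : ∀ k, ∀ v ∈ top k, vertex k (ρ v) = v

namespace RankedPartition

open MvPolynomial

variable {σ : Type*} [DecidableEq σ] {Δ : LowerSet (Finset σ)} {n : ℕ} {ρ : σ → Fin n} {ℓ : ℕ}
  (D : RankedPartition Δ ρ ℓ)

/-- The exponents whose support is a face. -/
abbrev FaceExponent (Δ : LowerSet (Finset σ)) : Type _ := {a : σ →₀ ℕ // a.support ∈ Δ}

/-- The index of the interval that contains the support of `a`. -/
noncomputable def index (a : FaceExponent Δ) : Fin ℓ := (D.exists_mem _ a.2).choose

theorem bot_index_subset (a : FaceExponent Δ) : D.bot (D.index a) ⊆ a.1.support :=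
  (D.exists_mem _ a.2).choose_spec.1

theorem subset_top_index (a : FaceExponent Δ) : a.1.support ⊆ D.top (D.index a) :=
  (D.exists_mem _ a.2).choose_spec.2

theorem index_mono {a b : FaceExponent Δ} (h : a.1.support ⊆ b.1.support) :
    D.index a ≤ D.index b :=
  D.le_of_subset _ _ ((D.bot_index_subset a).trans (h.trans (D.subset_top_index b)))

theorem index_eq {a : FaceExponent Δ} {k : Fin ℓ} (h₁ : D.bot k ⊆ a.1.support)
    (h₂ : a.1.support ⊆ D.top k) : D.index a = k :=
  le_antisymm (D.le_of_subset _ _ ((D.bot_index_subset a).trans h₂))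
    (D.le_of_subset _ _ (h₁.trans (D.subset_top_index a)))

/-- The exponent of the squarefree monomial of `bot k`. -/
noncomputable def botExponent (k : Fin ℓ) : σ →₀ ℕ := ∑ v ∈ D.bot k, Finsupp.single v 1

theorem botExponent_apply (k : Fin ℓ) (v : σ) :
    D.botExponent k v = if v ∈ D.bot k then 1 else 0 := by
  simp [botExponent, Finsupp.finsetSum_apply, Finsupp.single_apply]

/-- The exponent of `bot k` times the monomial in the vertices of `top k` whose exponents, by
ranks, are given by `m`. -/
noncomputable def pairExponent (p : Fin ℓ × (Fin n →₀ ℕ)) : σ →₀ ℕ :=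
  D.botExponent p.1 + p.2.mapDomain (D.vertex p.1)

theorem vertex_injective (k : Fin ℓ) : Function.Injective (D.vertex k) :=
  Function.LeftInverse.injective (D.rank_vertex k)

theorem pairExponent_support_subset (p : Fin ℓ × (Fin n →₀ ℕ)) :
    (D.pairExponent p).support ⊆ D.top p.1 := by
  intro v hv
  by_contra hvt
  have h1 : v ∉ D.bot p.1 := fun h => hvt (D.bot_subset _ h)
  have h2 : v ∉ Set.range (D.vertex p.1) := by
    rintro ⟨r, rfl⟩
    exact hvt (D.vertex_mem _ _)
  simp [pairExponent, botExponent_apply, h1, Finsupp.mapDomain_of_notMem_range _ _ h2] at hv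

theorem bot_subset_pairExponent_support (p : Fin ℓ × (Fin n →₀ ℕ)) :
    D.bot p.1 ⊆ (D.pairExponent p).support := by
  intro v hv
  simp [pairExponent, botExponent_apply, hv]

/-- `pairExponent` with values in the exponents whose support is a face. -/
noncomputable def pairFace (p : Fin ℓ × (Fin n →₀ ℕ)) : FaceExponent Δ :=
  ⟨D.pairExponent p, Δ.lower (D.pairExponent_support_subset p) (D.top_mem _)⟩

theorem index_pairFace (p : Fin ℓ × (Fin n →₀ ℕ)) : D.index (D.pairFace p) = p.1 :=
  D.index_eq (D.bot_subset_pairExponent_support p) (D.pairExponent_support_subset p)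

/-- The support of a face exponent lies in a single interval. After removal of the monomial of `bot
k`, the rest lives on `top k`, where a vertex is known by its rank. -/
theorem pairFace_bijective : Function.Bijective D.pairFace := by
  constructor
  · intro p q h
    have hk : p.1 = q.1 := by rw [← D.index_pairFace p, h, D.index_pairFace]
    obtain ⟨k, m⟩ := p
    obtain ⟨k', m'⟩ := q
    obtain rfl : k = k' := hk
    have := congrArg Subtype.val h
    simp only [pairFace, pairExponent, add_right_inj] at this
    rw [Finsupp.mapDomain_injective (D.vertex_injective k) this]
  · intro a
    refine ⟨(D.index a, (a.1 - D.botExponent (D.index a)).mapDomain ρ), Subtype.ext ?_⟩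
    have hle : D.botExponent (D.index a) ≤ a.1 := by
      intro v
      rw [botExponent_apply]
      split_ifs with h
      · have := D.bot_index_subset a h
        rw [Finsupp.mem_support_iff] at this
        omega
      · exact Nat.zero_le _
    have : ((a.1 - D.botExponent (D.index a)).mapDomain ρ).mapDomain (D.vertex (D.index a)) =
        a.1 - D.botExponent (D.index a) := by
      rw [← Finsupp.mapDomain_comp]
      conv_rhs => rw [← Finsupp.mapDomain_id (v := a.1 - D.botExponent (D.index a))]
      refine Finsupp.mapDomain_congr fun v hv => ?_
      refine D.vertex_rank _ _ (D.subset_top_index a ?_)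
      simp only [Finsupp.mem_support_iff, Finsupp.coe_tsub, Pi.sub_apply] at hv ⊢
      omega
    simp only [pairFace, pairExponent, this]
    exact add_tsub_cancel_of_le hle

theorem pairExponent_add_single (k : Fin ℓ) (m : Fin n →₀ ℕ) (r : Fin n) :
    D.pairExponent (k, m + Finsupp.single r 1) =
      D.pairExponent (k, m) + Finsupp.single (D.vertex k r) 1 := by
  simp [pairExponent, Finsupp.mapDomain_add, Finsupp.mapDomain_single, add_assoc]

/-- The weight of the exponent `a`, then the index of the interval of its support, reversed. -/
noncomputable def key (w : Fin n → ℕ) (a : FaceExponent Δ) : ℕ ×ₗ (Fin ℓ)ᵒᵈ :=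
  toLex (Finsupp.weight (w ∘ ρ) a.1, OrderDual.toDual (D.index a))

theorem key_lt_iff (w : Fin n → ℕ) (a b : FaceExponent Δ) : D.key w a < D.key w b ↔
    Finsupp.weight (w ∘ ρ) a.1 < Finsupp.weight (w ∘ ρ) b.1 ∨
      Finsupp.weight (w ∘ ρ) a.1 = Finsupp.weight (w ∘ ρ) b.1 ∧ D.index b < D.index a := by
  simp [key, Prod.Lex.lt_iff]

variable {k : Type*} [Field k] (I : Ideal (MvPolynomial σ k)) (w : Fin n → ℕ)

/-- `Straightens I w` says that, modulo `I`, a monomial whose support is not a face is `0` or a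
monomial of lower weight whose support is a face. -/
def Straightens (Δ : LowerSet (Finset σ)) (ρ : σ → Fin n) : Prop :=
  ∀ a : σ →₀ ℕ, a.support ∉ Δ → monomial a 1 ∈ I ∨ ∃ c : σ →₀ ℕ, c.support ∈ Δ ∧
    monomial a 1 - monomial c 1 ∈ I ∧ Finsupp.weight (w ∘ ρ) c < Finsupp.weight (w ∘ ρ) a

/-- The monomials whose supports are faces, modulo `I`. -/
noncomputable def faceMonomial (a : FaceExponent Δ) : MvPolynomial σ k ⧸ I :=
  Ideal.Quotient.mk I (monomial a.1 1)

/-- A linear relation would be a nonzero element of `I` with face monomials only. -/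
theorem linearIndependent_faceMonomial
    (hI : ∀ f ∈ I, (∀ a ∈ f.support, a.support ∈ Δ) → f = 0) :
    LinearIndependent k (faceMonomial (Δ := Δ) I) := by
  have h1 : LinearIndependent k fun a : FaceExponent Δ => (monomial a.1 1 : MvPolynomial σ k) := by
    have := (basisMonomials σ k).linearIndependent.comp (fun a : FaceExponent Δ => a.1)
      Subtype.val_injective
    simpa [Function.comp_def] using this
  refine h1.map (f := (Ideal.Quotient.mkₐ k I).toLinearMap) ?_
  rw [Submodule.disjoint_def]
  intro f hf hfI
  refine hI f ?_ ?_
  · simpa [Ideal.Quotient.eq_zero_iff_mem] using hfI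
  · clear hfI
    intro a ha
    by_contra hΔ
    have : coeff a f = 0 := by
      induction hf using Submodule.span_induction with
      | mem x hx =>
        obtain ⟨b, rfl⟩ := hx
        rw [coeff_monomial, if_neg]
        rintro rfl
        exact hΔ b.2
      | zero => simp
      | add x y _ _ hx hy =>
        by_cases h1 : a ∈ x.support <;> by_cases h2 : a ∈ y.support <;>
          simp_all
      | smul c x _ hx =>
        by_cases h1 : a ∈ x.support <;> simp_all
    exact (mem_support_iff.1 ha) this

omit [DecidableEq σ] in
theorem span_faceMonomial (hI : Straightens I w Δ ρ) :
    ⊤ ≤ Submodule.span k (Set.range (faceMonomial (Δ := Δ) I)) := by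
  rintro x -
  obtain ⟨f, rfl⟩ := Ideal.Quotient.mk_surjective x
  induction f using MvPolynomial.induction_on' with
  | add p q hp hq =>
    rw [map_add]
    exact Submodule.add_mem _ hp hq
  | monomial a c =>
    have : (Ideal.Quotient.mk I) (monomial a c) = c • Ideal.Quotient.mk I (monomial a 1) := by
      rw [← mul_one c, ← smul_eq_mul, ← smul_monomial, smul_eq_mul, mul_one]
      rfl
    rw [this]
    refine Submodule.smul_mem _ _ ?_
    by_cases ha : a.support ∈ Δ
    · exact Submodule.subset_span ⟨⟨a, ha⟩, rfl⟩
    · obtain h | ⟨b, hb, h, -⟩ := hI a ha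
      · rw [Ideal.Quotient.eq_zero_iff_mem.2 h]
        exact Submodule.zero_mem _
      · rw [Ideal.Quotient.eq.2 h]
        exact Submodule.subset_span ⟨⟨b, hb⟩, rfl⟩

/-- The span of the face monomials of lower key than `a`. -/
noncomputable def lower (a : FaceExponent Δ) : Submodule k (MvPolynomial σ k ⧸ I) :=
  Submodule.span k (faceMonomial I '' {b | D.key w b < D.key w a})

theorem mk_monomial_mem_lower (hI : Straightens I w Δ ρ) (a : FaceExponent Δ) (c : σ →₀ ℕ)
    (hw : Finsupp.weight (w ∘ ρ) c ≤ Finsupp.weight (w ∘ ρ) a.1)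
    (hc : ∀ h : c.support ∈ Δ, D.key w ⟨c, h⟩ < D.key w a) :
    Ideal.Quotient.mk I (monomial c 1) ∈ D.lower I w a := by
  by_cases h : c.support ∈ Δ
  · exact Submodule.subset_span ⟨⟨c, h⟩, hc h, rfl⟩
  · obtain h | ⟨b, hb, h, hlt⟩ := hI c h
    · rw [Ideal.Quotient.eq_zero_iff_mem.2 h]
      exact Submodule.zero_mem _
    · rw [Ideal.Quotient.eq.2 h]
      refine Submodule.subset_span ⟨⟨b, hb⟩, ?_, rfl⟩
      exact (D.key_lt_iff w _ _).2 (Or.inl (hlt.trans_le hw))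

variable [Fintype σ]

/-- The sum of the variables of rank `r`, modulo `I`. -/
noncomputable def rankSum (ρ : σ → Fin n) (r : Fin n) : MvPolynomial σ k ⧸ I :=
  ∑ v with ρ v = r, Ideal.Quotient.mk I (X v)

omit [DecidableEq σ] in
theorem rankSum_mul_mk_monomial (r : Fin n) (c : σ →₀ ℕ) :
    rankSum I ρ r * Ideal.Quotient.mk I (monomial c 1) =
      ∑ v with ρ v = r, Ideal.Quotient.mk I (monomial (c + Finsupp.single v 1) 1) := by
  rw [rankSum, Finset.sum_mul]
  refine Finset.sum_congr rfl fun v _ => ?_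
  rw [← map_mul, X, monomial_mul, add_comm, one_mul]

omit [DecidableEq σ] [Fintype σ] in
theorem weight_add_single (c : σ →₀ ℕ) (v : σ) :
    Finsupp.weight (w ∘ ρ) (c + Finsupp.single v 1) = Finsupp.weight (w ∘ ρ) c + w (ρ v) := by
  simp [Finsupp.weight_single]

/-- Multiplication by a rank sum respects the key order: it adds `w r` to every weight, the index
can only grow with the support, and straightening lowers the weight. -/
theorem rankSum_mul_mem_lower (hI : Straightens I w Δ ρ) (r : Fin n) (a a' : FaceExponent Δ)
    (hw : Finsupp.weight (w ∘ ρ) a'.1 = Finsupp.weight (w ∘ ρ) a.1 + w r)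
    (hi : D.index a' = D.index a) {x : MvPolynomial σ k ⧸ I} (hx : x ∈ D.lower I w a) :
    rankSum I ρ r * x ∈ D.lower I w a' := by
  induction hx using Submodule.span_induction with
  | zero => simp
  | add x y _ _ hx hy => rw [mul_add]; exact Submodule.add_mem _ hx hy
  | smul c x _ hx => rw [mul_smul_comm]; exact Submodule.smul_mem _ _ hx
  | mem x hx =>
    obtain ⟨b, hb, rfl⟩ := hx
    replace hb := (D.key_lt_iff w _ _).1 hb
    rw [faceMonomial, rankSum_mul_mk_monomial]
    refine Submodule.sum_mem _ fun v hv => ?_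
    obtain rfl : ρ v = r := by simpa using hv
    refine D.mk_monomial_mem_lower I w hI _ _ ?_ fun h => ?_
    · rw [weight_add_single]
      omega
    · rw [key_lt_iff, weight_add_single, hw, hi]
      have : D.index b ≤ D.index ⟨_, h⟩ := D.index_mono (by
        intro u hu
        simp only [Finsupp.mem_support_iff, Finsupp.add_apply] at hu ⊢
        omega)
      obtain hb | ⟨hb, hb'⟩ := hb
      · left
        omega
      · exact Or.inr ⟨by rw [hb], hb'.trans_le this⟩

/-- All terms of the product have equal weight. One comes from the vertex of rank `r` in `top k`.
Any other vertex of that rank is outside `top k`, so its term either straightens to lower weight or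
has larger index, which is a lower key since indices are reversed. -/
theorem rankSum_mul_faceMonomial_sub_mem_lower (hI : Straightens I w Δ ρ) (k : Fin ℓ)
    (m : Fin n →₀ ℕ) (r : Fin n) :
    rankSum I ρ r * faceMonomial I (D.pairFace (k, m)) -
      faceMonomial I (D.pairFace (k, m + Finsupp.single r 1)) ∈
        D.lower I w (D.pairFace (k, m + Finsupp.single r 1)) := by
  have hr : D.vertex k r ∈ ({v | ρ v = r} : Finset σ) := by simp [D.rank_vertex]
  rw [faceMonomial, rankSum_mul_mk_monomial, ← Finset.add_sum_erase _ _ hr, faceMonomial]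
  simp only [pairFace, pairExponent_add_single, add_sub_cancel_left]
  refine Submodule.sum_mem _ fun v hv => ?_
  have hw : Finsupp.weight (w ∘ ρ) (D.pairExponent (k, m) + Finsupp.single v 1) =
      Finsupp.weight (w ∘ ρ) (D.pairExponent (k, m) + Finsupp.single (D.vertex k r) 1) := by
    have : ρ v = r := by simpa using (Finset.mem_erase.1 hv).2
    rw [weight_add_single, weight_add_single, D.rank_vertex, this]
  refine D.mk_monomial_mem_lower I w hI _ _ hw.le fun h => ?_
  rw [key_lt_iff]
  refine Or.inr ⟨hw, ?_⟩
  have h1 : D.index (D.pairFace (k, m + Finsupp.single r 1)) = k := D.index_pairFace _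
  simp only [pairFace, pairExponent_add_single] at h1
  rw [h1]
  refine lt_of_le_of_ne (D.le_of_subset _ _ ((D.bot_subset_pairExponent_support (k, m)).trans
    (Finset.Subset.trans ?_ (D.subset_top_index _)))) ?_
  · intro u hu
    simp only [Finsupp.mem_support_iff, Finsupp.add_apply] at hu ⊢
    omega
  · intro heq
    have hvt : v ∈ D.top k := by
      rw [heq]
      apply D.subset_top_index
      simp
    have h2 : ρ v = r ∧ v ≠ D.vertex k r := by
      simpa [and_comm] using hv
    exact h2.2 (by rw [← h2.1, D.vertex_rank k v hvt])

theorem aeval_rankSum_mul_sub_mem_lower (hI : Straightens I w Δ ρ) (p : Fin ℓ × (Fin n →₀ ℕ)) :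
    aeval (R := k) (rankSum I ρ) (monomial p.2 1) *
        Ideal.Quotient.mk I (monomial (D.botExponent p.1) 1) - faceMonomial I (D.pairFace p) ∈
      D.lower I w (D.pairFace p) := by
  obtain ⟨j, m⟩ := p
  induction hd : m.degree generalizing m with
  | zero =>
    rw [Finsupp.degree_eq_zero_iff] at hd
    subst hd
    have : aeval (R := k) (rankSum I ρ) (monomial 0 1) = 1 := by simp
    simp only [this, one_mul, faceMonomial, pairFace, pairExponent, Finsupp.mapDomain_zero,
      add_zero, sub_self]
    exact Submodule.zero_mem _
  | succ d ih =>
    have hm : m ≠ 0 := by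
      rintro rfl
      simp at hd
    obtain ⟨r, hr⟩ := Finsupp.ne_iff.1 hm
    obtain ⟨m', rfl⟩ : ∃ m', m = m' + Finsupp.single r 1 :=
      ⟨m - Finsupp.single r 1, (tsub_add_cancel_of_le (by
        rw [Finsupp.single_le_iff]
        have : m r ≠ 0 := hr
        omega)).symm⟩
    have hd' : m'.degree = d := by simpa using hd
    have h1 := ih m' hd'
    have h2 := D.rankSum_mul_mem_lower I w hI r _ (D.pairFace (j, m' + Finsupp.single r 1))
      (by simp only [pairFace, pairExponent_add_single]; rw [weight_add_single, D.rank_vertex])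
      (by rw [index_pairFace, index_pairFace]) h1
    have h3 := D.rankSum_mul_faceMonomial_sub_mem_lower I w hI j m' r
    have h4 : aeval (R := k) (rankSum I ρ) (monomial (m' + Finsupp.single r 1) 1) =
        rankSum I ρ r * aeval (R := k) (rankSum I ρ) (monomial m' 1) := by
      rw [← one_mul (1 : k), ← monomial_mul, map_mul, mul_comm]
      congr 1
      · exact aeval_X _ _
      · rw [one_mul]
    convert Submodule.add_mem _ h2 h3 using 1
    simp only [h4]
    ring

include D in
theorem isCohenMacaulayRing_quotient [IsAlgClosed k] (hstr : Straightens I w Δ ρ)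
    (hind : ∀ f ∈ I, (∀ a ∈ f.support, a.support ∈ Δ) → f = 0) :
    IsCohenMacaulayRing (MvPolynomial σ k ⧸ I) := by
  let e : Module.Basis (FaceExponent Δ) k (MvPolynomial σ k ⧸ I) :=
    Module.Basis.mk (linearIndependent_faceMonomial I hind) (span_faceMonomial I w hstr)
  let E := Equiv.ofBijective _ D.pairFace_bijective
  let f : Fin ℓ × (Fin n →₀ ℕ) → MvPolynomial σ k ⧸ I := fun p =>
    aeval (R := k) (rankSum I ρ) (monomial p.2 1) *
        Ideal.Quotient.mk I (monomial (D.botExponent p.1) 1)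
  obtain ⟨h1, h2⟩ := LinearIndependent.and_span_of_triangular e (f ∘ E.symm) (D.key w) (by
    intro a
    obtain ⟨p, rfl⟩ := E.surjective a
    simpa [e, f, lower, E] using D.aeval_rankSum_mul_sub_mem_lower I w hstr p)
  rw [E.symm.surjective.range_comp] at h2
  rw [linearIndependent_equiv] at h1
  -- The polynomial ring in `n` variables acts through the rank sums.
  let _ := (aeval (R := k) (rankSum I ρ)).toRingHom.toAlgebra
  have : IsScalarTower k (MvPolynomial (Fin n) k) (MvPolynomial σ k ⧸ I) :=
    IsScalarTower.of_algebraMap_eq' (aeval (R := k) (rankSum I ρ)).comp_algebraMap.symm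
  have hf : f = fun p => basisMonomials (Fin n) k p.2 •
      Ideal.Quotient.mk I (monomial (D.botExponent p.1) 1) := by
    funext p
    rw [coe_basisMonomials, Algebra.smul_def]
    rfl
  rw [hf] at h1 h2
  obtain ⟨_, _⟩ := Module.free_and_finite_of_smul_basis (basisMonomials (Fin n) k)
    (fun j => Ideal.Quotient.mk I (monomial (D.botExponent j) 1)) h1 h2
  exact isCohenMacaulayRing_of_finite_of_flat (k := k) (n := n) _

end RankedPartition

/-! ### Positions as intervals, and their lengths -/

namespace UpperPos

variable {n : ℕ}

theorem fst_lt_snd (p : UpperPos n) : (p.1.1 : ℕ) < p.1.2 := p.2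

theorem snd_le (p : UpperPos n) : (p.1.2 : ℕ) ≤ n := Nat.le_of_lt_succ p.1.2.2

theorem ext_nat {p q : UpperPos n} (h₁ : (p.1.1 : ℕ) = q.1.1) (h₂ : (p.1.2 : ℕ) = q.1.2) : p = q :=
  Subtype.ext (Prod.ext (Fin.ext h₁) (Fin.ext h₂))

/-- The position with the given coordinates. -/
def mk (i j : ℕ) (hij : i < j) (hj : j ≤ n) : UpperPos n :=
  ⟨(⟨i, by omega⟩, ⟨j, by omega⟩), hij⟩

@[simp] theorem mk_fst (i j : ℕ) (hij : i < j) (hj : j ≤ n) : ((mk i j hij hj).1.1 : ℕ) = i := rfl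

@[simp] theorem mk_snd (i j : ℕ) (hij : i < j) (hj : j ≤ n) : ((mk i j hij hj).1.2 : ℕ) = j := rfl

/-- The length of the interval. -/
def len (p : UpperPos n) : ℕ := (p.1.2 : ℕ) - p.1.1

theorem len_pos (p : UpperPos n) : 0 < p.len := Nat.sub_pos_of_lt p.fst_lt_snd

theorem len_le (p : UpperPos n) : p.len ≤ n := (Nat.sub_le _ _).trans p.snd_le

theorem intervalLE_iff {p q : UpperPos n} :
    IntervalLE p q ↔ (q.1.1 : ℕ) ≤ p.1.1 ∧ (p.1.2 : ℕ) ≤ q.1.2 :=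
  Set.Icc_subset_Icc_iff p.2.le

theorem eq_of_isChain_of_len_eq {S : Set (UpperPos n)} (hS : IsChain IntervalLE S) {p q : UpperPos n}
    (hp : p ∈ S) (hq : q ∈ S) (h : p.len = q.len) : p = q := by
  by_contra hne
  have := p.fst_lt_snd
  have := q.fst_lt_snd
  unfold len at h
  obtain h' | h' := hS hp hq hne <;> rw [intervalLE_iff] at h' <;>
    exact hne (ext_nat (by omega) (by omega))

end UpperPos

/-! ### Lattice paths are the facets of the interval complex -/

section LatticePaths

open UpperPos

variable {n : ℕ}

/-- A step of a lattice path. -/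
abbrev LatticeStep (p q : UpperPos n) : Prop := NorthStep p q ∨ EastStep p q

/-- A list of positions that ends in the northeast corner. -/
abbrev EndsInCorner (P : List (UpperPos n)) : Prop := ∃ p ∈ P.getLast?, p.1 = (0, Fin.last n)

theorem endsInCorner_cons_cons {p q : UpperPos n} {P : List (UpperPos n)} :
    EndsInCorner (p :: q :: P) ↔ EndsInCorner (q :: P) := by
  simp [EndsInCorner]

theorem endsInCorner_singleton {p : UpperPos n} :
    EndsInCorner [p] ↔ (p.1.1 : ℕ) = 0 ∧ (p.1.2 : ℕ) = n := by
  have : EndsInCorner [p] ↔ p.1 = (0, Fin.last n) := by simp [EndsInCorner]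
  rw [this, Prod.ext_iff, Fin.ext_iff, Fin.ext_iff]
  rfl

theorem LatticeStep.len_eq {p q : UpperPos n} (h : LatticeStep p q) : q.len = p.len + 1 := by
  have := p.fst_lt_snd
  have := q.fst_lt_snd
  obtain ⟨h1, h2⟩ | ⟨h1, h2⟩ := h <;> simp only [Fin.ext_iff] at h1 h2 <;> unfold len <;> omega

/-- All paths from `v` to the northeast corner, provided `d + v.len = n`. -/
def pathsFrom : ℕ → UpperPos n → List (List (UpperPos n))
  | 0, v => [[v]]
  | d + 1, v =>
    (if 0 < (v.1.1 : ℕ) then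
      (pathsFrom d (mk (v.1.1 - 1) v.1.2 (by have := v.fst_lt_snd; omega) v.snd_le)).map (v :: ·)
      else []) ++
    (if h : (v.1.2 : ℕ) < n then
      (pathsFrom d (mk v.1.1 (v.1.2 + 1) (by have := v.fst_lt_snd; omega) h)).map (v :: ·)
      else [])

theorem mem_pathsFrom {d : ℕ} {v : UpperPos n} (hd : d + v.len = n) {P : List (UpperPos n)} :
    P ∈ pathsFrom d v ↔ P.head? = some v ∧ EndsInCorner P ∧ P.IsChain LatticeStep := by
  induction d generalizing v P with
  | zero =>
    have := v.fst_lt_snd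
    have := v.snd_le
    have hl := hd
    unfold len at hl
    simp only [pathsFrom, List.mem_singleton]
    constructor
    · rintro rfl
      refine ⟨rfl, endsInCorner_singleton.2 (by omega), by simp⟩
    · rintro ⟨h1, -, h3⟩
      obtain _ | ⟨p, _ | ⟨q, P⟩⟩ := P
      · simp at h1
      · simpa using h1
      · obtain rfl : p = v := by simpa using h1
        rw [List.isChain_cons_cons] at h3
        have := LatticeStep.len_eq h3.1
        have := q.len_le
        omega
  | succ d ih =>
    have hlt := v.fst_lt_snd
    have hle := v.snd_le
    have hl := hd
    unfold len at hl
    constructor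
    · intro h
      simp only [pathsFrom, List.mem_append] at h
      obtain h | h := h
      · split_ifs at h with h0
        · obtain ⟨Q, hQ, rfl⟩ := List.mem_map.1 h
          rw [ih (by simp only [len, mk_fst, mk_snd]; omega)] at hQ
          obtain ⟨h1, h2, h3⟩ := hQ
          obtain _ | ⟨q, Q⟩ := Q
          · simp at h1
          obtain rfl := Option.some.inj h1
          refine ⟨rfl, endsInCorner_cons_cons.2 h2, List.isChain_cons_cons.2 ⟨Or.inl ⟨?_, rfl⟩, h3⟩⟩
          rw [mk_fst]
          omega
        · simp at h
      · split_ifs at h with h0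
        · obtain ⟨Q, hQ, rfl⟩ := List.mem_map.1 h
          rw [ih (by simp only [len, mk_fst, mk_snd]; omega)] at hQ
          obtain ⟨h1, h2, h3⟩ := hQ
          obtain _ | ⟨q, Q⟩ := Q
          · simp at h1
          obtain rfl := Option.some.inj h1
          exact ⟨rfl, endsInCorner_cons_cons.2 h2, List.isChain_cons_cons.2 ⟨Or.inr ⟨rfl, rfl⟩, h3⟩⟩
        · simp at h
    · rintro ⟨h1, h2, h3⟩
      obtain _ | ⟨p, _ | ⟨q, P⟩⟩ := P
      · simp at h1
      · obtain rfl : p = v := by simpa using h1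
        rw [endsInCorner_singleton] at h2
        omega
      · obtain rfl : p = v := by simpa using h1
        rw [List.isChain_cons_cons] at h3
        rw [endsInCorner_cons_cons] at h2
        have hq := q.snd_le
        simp only [pathsFrom, List.mem_append]
        obtain ⟨⟨h4, h5⟩ | ⟨h4, h5⟩, h6⟩ := h3
        · left
          rw [if_pos (by omega)]
          refine List.mem_map.2 ⟨q :: P, (ih ?_).2 ⟨?_, h2, h6⟩, rfl⟩
          · simp only [len, mk_fst, mk_snd]; omega
          · rw [List.head?_cons]
            exact congrArg some (ext_nat (by rw [mk_fst]; omega) (by rw [mk_snd, h5]))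
        · right
          rw [dif_pos (by omega)]
          refine List.mem_map.2 ⟨q :: P, (ih ?_).2 ⟨?_, h2, h6⟩, rfl⟩
          · simp only [len, mk_fst, mk_snd]; omega
          · rw [List.head?_cons]
            exact congrArg some (ext_nat (by rw [mk_fst, h4]) (by rw [mk_snd, h5]))

theorem PathPrecedes.cons {P Q : List (UpperPos n)} (v : UpperPos n) (hh : P.head? = Q.head?)
    (h : PathPrecedes P Q) : PathPrecedes (v :: P) (v :: Q) := by
  obtain ⟨p, hp, q, hq, hlt⟩ | ⟨l, u, p, q, P', Q', rfl, rfl, hN, hE⟩ := h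
  · rw [hh] at hp
    obtain rfl := Option.mem_unique hp hq
    exact absurd hlt (lt_irrefl _)
  · exact Or.inr ⟨v :: l, u, p, q, P', Q', rfl, rfl, hN, hE⟩

/-- The recursion lists the northward continuations before the eastward ones. -/
theorem pairwise_pathsFrom {d : ℕ} {v : UpperPos n} (hd : d + v.len = n) :
    (pathsFrom d v).Pairwise PathPrecedes := by
  induction d generalizing v with
  | zero => simp [pathsFrom]
  | succ d ih =>
    have hlt := v.fst_lt_snd
    have hle := v.snd_le
    have hl := hd
    unfold len at hl
    have key : ∀ u : UpperPos n, d + u.len = n →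
        ((pathsFrom d u).map (v :: ·)).Pairwise PathPrecedes := by
      intro u hu
      rw [List.pairwise_map]
      refine (ih hu).imp_of_mem fun hP hQ h => h.cons v ?_
      rw [((mem_pathsFrom hu).1 hP).1, ((mem_pathsFrom hu).1 hQ).1]
    rw [pathsFrom, List.pairwise_append]
    refine ⟨?_, ?_, ?_⟩
    · split_ifs
      · exact key _ (by simp only [len, mk_fst, mk_snd]; omega)
      · simp
    · split_ifs
      · exact key _ (by simp only [len, mk_fst, mk_snd]; omega)
      · simp
    · intro P hP Q hQ
      split_ifs at hP hQ with h1 h2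
      · obtain ⟨P', hP', rfl⟩ := List.mem_map.1 hP
        obtain ⟨Q', hQ', rfl⟩ := List.mem_map.1 hQ
        rw [mem_pathsFrom (by simp only [len, mk_fst, mk_snd]; omega)] at hP' hQ'
        obtain _ | ⟨p, P⟩ := P'
        · simp at hP'
        obtain _ | ⟨q, Q⟩ := Q'
        · simp at hQ'
        obtain rfl := Option.some.inj hP'.1
        obtain rfl := Option.some.inj hQ'.1
        exact Or.inr ⟨[], v, _, _, P, Q, rfl, rfl, ⟨by rw [mk_fst]; omega, rfl⟩, rfl, rfl⟩
      all_goals simp at hP hQ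

/-- All lattice paths. -/
def latticePaths (n : ℕ) : List (List (UpperPos n)) :=
  (List.finRange n).flatMap fun i : Fin n => pathsFrom (n - 1) (mk i (i + 1) (by omega) i.2)

theorem mem_latticePaths {P : List (UpperPos n)} : P ∈ latticePaths n ↔ IsLatticePath P := by
  simp only [latticePaths, List.mem_flatMap, List.mem_finRange, true_and]
  constructor
  · rintro ⟨i, hi⟩
    have := i.2
    rw [mem_pathsFrom (by simp only [len, mk_fst, mk_snd]; omega)] at hi
    exact ⟨⟨_, hi.1, rfl⟩, hi.2.1, hi.2.2⟩
  · rintro ⟨⟨p, hp, hp'⟩, h2, h3⟩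
    have := p.snd_le
    refine ⟨⟨p.1.1, by omega⟩, ?_⟩
    rw [mem_pathsFrom (by simp only [len, mk_fst, mk_snd]; omega)]
    refine ⟨?_, h2, h3⟩
    rw [hp]
    exact congrArg some (ext_nat rfl (by rw [mk_snd, hp']))

theorem pairwise_latticePaths : (latticePaths n).Pairwise PathPrecedes := by
  have hd : ∀ i : Fin n, n - 1 + (mk (n := n) i (i + 1) (by omega) i.2).len = n := by
    intro i
    have := i.2
    simp only [len, mk_fst, mk_snd]
    omega
  rw [latticePaths, List.pairwise_flatMap]
  refine ⟨fun i _ => pairwise_pathsFrom (hd i), ?_⟩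
  refine (List.pairwise_lt_finRange n).imp fun {i j} hij P hP Q hQ => Or.inl ?_
  exact ⟨_, ((mem_pathsFrom (hd i)).1 hP).1, _, ((mem_pathsFrom (hd j)).1 hQ).1, hij⟩

/-- `q` strictly contains `p`. -/
def StrictlyInside (p q : UpperPos n) : Prop :=
  (q.1.1 : ℕ) ≤ p.1.1 ∧ (p.1.2 : ℕ) ≤ q.1.2 ∧ p.len < q.len

instance : IsTrans (UpperPos n) StrictlyInside where
  trans _ _ _ h₁ h₂ := ⟨h₂.1.trans h₁.1, h₁.2.1.trans h₂.2.1, h₁.2.2.trans h₂.2.2⟩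

theorem pairwise_of_isChain_latticeStep {P : List (UpperPos n)} (h : P.IsChain LatticeStep) :
    P.Pairwise StrictlyInside := by
  rw [← List.isChain_iff_pairwise]
  refine h.imp fun p q h => ⟨?_, ?_, by rw [h.len_eq]; omega⟩ <;>
    obtain ⟨h1, h2⟩ | ⟨h1, h2⟩ := h <;> simp only [Fin.ext_iff] at h1 h2 <;> omega

theorem isChain_toFinset_of_isChain_latticeStep {P : List (UpperPos n)}
    (h : P.IsChain LatticeStep) : P.toFinset ∈ intervalComplex n := by
  change IsChain IntervalLE (P.toFinset : Set (UpperPos n))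
  have hP : P.Pairwise fun p q => IntervalLE p q ∨ IntervalLE q p :=
    (pairwise_of_isChain_latticeStep h).imp fun h => Or.inl (intervalLE_iff.2 ⟨h.1, h.2.1⟩)
  intro p hp q hq hne
  simp only [List.coe_toFinset, Set.mem_ofPred_eq] at hp hq
  have : Std.Symm fun p q : UpperPos n => IntervalLE p q ∨ IntervalLE q p := ⟨fun _ _ h => h.symm⟩
  exact hP.forall hp hq hne

theorem exists_mem_len_eq {v : UpperPos n} {P : List (UpperPos n)}
    (h : (v :: P).IsChain LatticeStep) (hc : EndsInCorner (v :: P)) {d : ℕ} (h₁ : v.len ≤ d)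
    (h₂ : d ≤ n) : ∃ u ∈ v :: P, u.len = d := by
  induction P generalizing v with
  | nil =>
    rw [endsInCorner_singleton] at hc
    have : v.len = n := by unfold len; omega
    exact ⟨v, by simp, by omega⟩
  | cons q P ih =>
    rw [List.isChain_cons_cons] at h
    rw [endsInCorner_cons_cons] at hc
    obtain h₃ | h₃ := h₁.eq_or_lt
    · exact ⟨v, by simp, h₃⟩
    · obtain ⟨u, hu, hd⟩ := ih h.2 hc (by rw [h.1.len_eq]; omega)
      exact ⟨u, List.mem_cons_of_mem _ hu, hd⟩

theorem IsLatticePath.exists_mem_len_eq {P : List (UpperPos n)} (h : IsLatticePath P) {d : ℕ}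
    (h₁ : 1 ≤ d) (h₂ : d ≤ n) : ∃ u ∈ P.toFinset, u.len = d := by
  obtain ⟨⟨p, hp, hp'⟩, hc, hs⟩ := h
  obtain _ | ⟨v, P⟩ := P
  · simp at hp
  obtain rfl : v = p := by simpa using hp
  obtain ⟨u, hu⟩ := _root_.exists_mem_len_eq hs hc (d := d) (by unfold len; omega) h₂
  exact ⟨u, by simpa using hu⟩

/-- Go north if all other members of `S` have smaller left ends, east if all have larger right ends.
If neither step is allowed, some member shares its left end with `v` and another its right end, and
these two are incomparable; at the border, such a member would be `v` itself. -/
theorem exists_path_of_chain {d : ℕ} {v : UpperPos n} (hd : d + v.len = n) {S : Finset (UpperPos n)}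
    (hS : S ∈ intervalComplex n) (hv : ∀ s ∈ S, IntervalLE v s) :
    ∃ P, P.head? = some v ∧ EndsInCorner P ∧ P.IsChain LatticeStep ∧ S ⊆ P.toFinset := by
  induction d generalizing v S with
  | zero =>
    have hl := hd
    unfold len at hl
    have := v.fst_lt_snd
    have := v.snd_le
    refine ⟨[v], rfl, endsInCorner_singleton.2 (by omega), by simp, fun s hs => ?_⟩
    have h := intervalLE_iff.1 (hv s hs)
    have := s.snd_le
    simpa using ext_nat (p := s) (q := v) (by omega) (by omega)
  | succ d ih =>
    have hl := hd
    unfold len at hl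
    have hlt := v.fst_lt_snd
    have hle := v.snd_le
    have step : ∀ u : UpperPos n, LatticeStep v u → (∀ s ∈ S.erase v, IntervalLE u s) →
        ∃ P, P.head? = some v ∧ EndsInCorner P ∧ P.IsChain LatticeStep ∧ S ⊆ P.toFinset := by
      intro u hu hSu
      obtain ⟨P, h1, h2, h3, h4⟩ := ih (v := u) (by rw [hu.len_eq]; omega)
        ((intervalComplex n).lower (Finset.erase_subset v S) hS) hSu
      obtain _ | ⟨p, P⟩ := P
      · simp at h1
      obtain rfl : p = u := by simpa using h1
      refine ⟨v :: p :: P, rfl, endsInCorner_cons_cons.2 h2, List.isChain_cons_cons.2 ⟨hu, h3⟩, ?_⟩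
      rw [List.toFinset_cons]
      exact Finset.subset_insert_iff.2 h4
    by_cases hN : 0 < (v.1.1 : ℕ) ∧ ∀ s ∈ S.erase v, (s.1.1 : ℕ) < v.1.1
    · refine step (mk (v.1.1 - 1) v.1.2 (by omega) v.snd_le) (Or.inl ⟨by rw [mk_fst]; omega, rfl⟩)
        fun s hs => intervalLE_iff.2 ?_
      have h1 := intervalLE_iff.1 (hv s (Finset.mem_of_mem_erase hs))
      have h2 := hN.2 s hs
      simp only [mk_fst, mk_snd]
      omega
    by_cases hE : (v.1.2 : ℕ) < n ∧ ∀ s ∈ S.erase v, (v.1.2 : ℕ) < s.1.2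
    · refine step (mk v.1.1 (v.1.2 + 1) (by omega) hE.1) (Or.inr ⟨rfl, rfl⟩)
        fun s hs => intervalLE_iff.2 ?_
      have h1 := intervalLE_iff.1 (hv s (Finset.mem_of_mem_erase hs))
      have h2 := hE.2 s hs
      simp only [mk_fst, mk_snd]
      omega
    exfalso
    have hne : ∀ s ∈ S.erase v, ¬ ((s.1.1 : ℕ) = v.1.1 ∧ (s.1.2 : ℕ) = v.1.2) := fun s hs h =>
      Finset.ne_of_mem_erase hs (ext_nat h.1 h.2)
    have hin : ∀ s ∈ S.erase v, (s.1.1 : ℕ) ≤ v.1.1 ∧ (v.1.2 : ℕ) ≤ s.1.2 ∧ (s.1.2 : ℕ) ≤ n :=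
      fun s hs => ⟨(intervalLE_iff.1 (hv s (Finset.mem_of_mem_erase hs))).1,
        (intervalLE_iff.1 (hv s (Finset.mem_of_mem_erase hs))).2, s.snd_le⟩
    rw [not_and_or] at hN hE
    push Not at hN hE
    obtain hN | ⟨s, hs, hsN⟩ := hN
    · obtain hE | ⟨t, ht, htE⟩ := hE
      · omega
      · have := hne t ht
        have := hin t ht
        omega
    · obtain hE | ⟨t, ht, htE⟩ := hE
      · have := hne s hs
        have := hin s hs
        omega
      · have h1 := hne s hs
        have h2 := hne t ht
        have h3 := hin s hs
        have h4 := hin t ht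
        have hst : s ≠ t := by
          rintro rfl
          omega
        have : IntervalLE s t ∨ IntervalLE t s := hS (Finset.mem_of_mem_erase hs) (Finset.mem_of_mem_erase ht) hst
        rw [intervalLE_iff, intervalLE_iff] at this
        omega

theorem exists_isLatticePath_of_chain (hn : 1 ≤ n) {S : Finset (UpperPos n)}
    (hS : S ∈ intervalComplex n) : ∃ P, IsLatticePath P ∧ S ⊆ P.toFinset := by
  obtain ⟨v, hv1, hv⟩ : ∃ v : UpperPos n, (v.1.2 : ℕ) = v.1.1 + 1 ∧ ∀ s ∈ S, IntervalLE v s := by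
    obtain rfl | hne := S.eq_empty_or_nonempty
    · exact ⟨mk 0 1 (by omega) hn, rfl, by simp⟩
    · obtain ⟨s, hs, hmin⟩ := Finset.exists_min_image S len hne
      have h1 := s.fst_lt_snd
      have h2 := s.snd_le
      -- A unit interval inside the shortest member lies inside all members of the chain.
      refine ⟨mk s.1.1 (s.1.1 + 1) (by omega) (by omega), rfl, fun t ht => ?_⟩
      rw [intervalLE_iff, mk_fst, mk_snd]
      obtain rfl | hst := eq_or_ne s t
      · omega
      · have h3 := hmin t ht
        unfold len at h3
        have : IntervalLE s t ∨ IntervalLE t s := hS hs ht hst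
        rw [intervalLE_iff, intervalLE_iff] at this
        omega
  obtain ⟨P, h1, h2, h3, h4⟩ := exists_path_of_chain (d := n - 1) (v := v)
    (by unfold len; omega) hS hv
  exact ⟨P, ⟨⟨v, h1, hv1⟩, h2, h3⟩, h4⟩

/-- A path has a vertex of every length, and a chain has at most one of each, so nothing can be
added. -/
theorem IsLatticePath.isFacet {P : List (UpperPos n)} (h : IsLatticePath P) :
    IsFacet (intervalComplex n) P.toFinset := by
  refine ⟨isChain_toFinset_of_isChain_latticeStep h.2.2, fun S hS hle s hs => ?_⟩
  obtain ⟨u, hu, hus⟩ := h.exists_mem_len_eq s.len_pos s.len_le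
  rwa [← eq_of_isChain_of_len_eq hS (hle hu) hs hus]

theorem isFacet_intervalComplex_iff (hn : 1 ≤ n) {F : Finset (UpperPos n)} :
    IsFacet (intervalComplex n) F ↔ ∃ P, IsLatticePath P ∧ P.toFinset = F := by
  constructor
  · intro hF
    obtain ⟨P, hP, hFP⟩ := exists_isLatticePath_of_chain hn hF.1
    exact ⟨P, hP, (hF.eq_of_le hP.isFacet.1 hFP).symm⟩
  · rintro ⟨P, hP, rfl⟩
    exact hP.isFacet

theorem IsFacet.card_intervalComplex (hn : 1 ≤ n) {F : Finset (UpperPos n)}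
    (hF : IsFacet (intervalComplex n) F) : F.card = n := by
  obtain ⟨P, hP, rfl⟩ := (isFacet_intervalComplex_iff hn).1 hF
  have h1 : P.toFinset.image len = Finset.Icc 1 n := by
    ext d
    simp only [Finset.mem_image, Finset.mem_Icc]
    constructor
    · rintro ⟨u, -, rfl⟩
      exact ⟨u.len_pos, u.len_le⟩
    · rintro ⟨h1, h2⟩
      exact hP.exists_mem_len_eq h1 h2
  rw [← Finset.card_image_of_injOn (f := len), h1]
  · simp
  · exact fun p hp q hq h => eq_of_isChain_of_len_eq hF.1 hp hq h

end LatticePaths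

/-! ### The exchange property and the shelling -/

section Shelling

open UpperPos

variable {n : ℕ}

theorem endsInCorner_append_cons {l P : List (UpperPos n)} {p : UpperPos n} :
    EndsInCorner (l ++ p :: P) ↔ EndsInCorner (p :: P) := by
  simp [EndsInCorner, List.getLast?_append, List.getLast?_cons]

/-- A path below the top row must go north again. The corner `u` is the end of its eastward run from
`v`. -/
theorem exists_turn {v q : UpperPos n} {T : List (UpperPos n)} (hE : EastStep v q)
    (h : (v :: q :: T).IsChain LatticeStep) (hc : EndsInCorner (v :: q :: T)) (h0 : 0 < (v.1.1 : ℕ)) :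
    ∃ l a u b T', v :: q :: T = l ++ a :: u :: b :: T' ∧ EastStep a u ∧ NorthStep u b ∧
      (u.1.1 : ℕ) = v.1.1 ∧ (v.1.2 : ℕ) < u.1.2 := by
  induction T generalizing v q with
  | nil =>
    rw [endsInCorner_cons_cons, endsInCorner_singleton, hE.1] at hc
    omega
  | cons b T ih =>
    have h' := (List.isChain_cons_cons.1 h).2
    have hE2 := hE.2
    have hE1 : (q.1.1 : ℕ) = v.1.1 := by rw [hE.1]
    obtain hN | hE' := (List.isChain_cons_cons.1 h').1
    · exact ⟨[], v, q, b, T, rfl, hE, hN, hE1, by omega⟩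
    · obtain ⟨l, a, u, b', T', h1, h2, h3, h4, h5⟩ :=
        ih hE' h' (endsInCorner_cons_cons.1 hc) (by omega)
      exact ⟨v :: l, a, u, b', T', by rw [h1, List.cons_append], h2, h3, by omega, by omega⟩

theorem IsLatticePath.exists_swap {L T : List (UpperPos n)} {a u b : UpperPos n}
    (h : IsLatticePath (L ++ a :: u :: b :: T)) (hE : EastStep a u) (hN : NorthStep u b) :
    ∃ w, NorthStep a w ∧ IsLatticePath (L ++ a :: w :: b :: T) := by
  obtain ⟨h1, h2, h3⟩ := h
  have ha := a.fst_lt_snd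
  have hE1 : (u.1.1 : ℕ) = a.1.1 := by rw [hE.1]
  have hN1 := hN.1
  have hN2 : (b.1.2 : ℕ) = u.1.2 := by rw [hN.2]
  have hE2 := hE.2
  have hw : NorthStep a (mk (a.1.1 - 1) a.1.2 (by omega) a.snd_le) :=
    ⟨by rw [mk_fst]; omega, Fin.ext rfl⟩
  have hw' : EastStep (mk (a.1.1 - 1) a.1.2 (by omega) a.snd_le) b :=
    ⟨Fin.ext (by rw [mk_fst]; omega), by rw [mk_snd]; omega⟩
  refine ⟨_, hw, ?_, ?_, ?_⟩
  · simpa using h1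
  · change EndsInCorner _ at h2 ⊢
    rw [endsInCorner_append_cons, endsInCorner_cons_cons, endsInCorner_cons_cons] at h2 ⊢
    exact h2
  · rw [List.isChain_append] at h3 ⊢
    refine ⟨h3.1, ?_, ?_⟩
    · have := h3.2.1
      simp only [List.isChain_cons_cons] at this ⊢
      exact ⟨Or.inl hw, Or.inr hw', this.2.2⟩
    · simpa using h3.2.2

theorem erase_toFinset_subset {L T : List (UpperPos n)} (u w : UpperPos n) :
    (L ++ u :: T).toFinset.erase u ⊆ (L ++ w :: T).toFinset := by
  intro x
  simp only [Finset.mem_erase, List.mem_toFinset, List.mem_append, List.mem_cons]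
  tauto

theorem exists_exchange_of_turn {L T : List (UpperPos n)} {a u b : UpperPos n}
    (h : IsLatticePath (L ++ a :: u :: b :: T)) (hE : EastStep a u) (hN : NorthStep u b) :
    ∃ Q, IsLatticePath Q ∧ PathPrecedes Q (L ++ a :: u :: b :: T) ∧
      (L ++ a :: u :: b :: T).toFinset.erase u ⊆ Q.toFinset := by
  obtain ⟨w, hw, hQ⟩ := h.exists_swap hE hN
  refine ⟨_, hQ, Or.inr ⟨L, a, w, u, _, _, rfl, rfl, hw, hE⟩, ?_⟩
  simpa using erase_toFinset_subset (L := L ++ [a]) (T := b :: T) u w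

/-- This yields the shelling: an earlier path misses a vertex `u` of `P` whose removal leaves a face
of an earlier path. Usually `u` is an east-north corner in the row where `P` goes east; `F` avoids
it because there `F` is in higher rows or not far enough east. -/
theorem PathPrecedes.exists_exchange {F P : List (UpperPos n)} (hF : IsLatticePath F)
    (hP : IsLatticePath P) (h : PathPrecedes F P) :
    ∃ u ∈ P, u ∉ F ∧ ∃ Q, IsLatticePath Q ∧ PathPrecedes Q P ∧
      P.toFinset.erase u ⊆ Q.toFinset := by
  obtain ⟨f, hf, x, hx, hlt⟩ | ⟨l, v, p, q, P', Q', rfl, rfl, hN, hE⟩ := h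
  · have hFrow : ∀ y ∈ F, (y.1.1 : ℕ) < x.1.1 := by
      intro y hy
      obtain _ | ⟨f', F⟩ := F
      · simp at hy
      obtain rfl : f' = f := by simpa using hf
      have h1 : (f'.1.1 : ℕ) < x.1.1 := hlt
      obtain rfl | hy := List.mem_cons.1 hy
      · exact h1
      · exact lt_of_le_of_lt
          ((List.pairwise_cons.1 (pairwise_of_isChain_latticeStep hF.2.2)).1 y hy).1 h1
    have hlt' : (f.1.1 : ℕ) < x.1.1 := hlt
    obtain _ | ⟨x', T⟩ := P
    · simp at hx
    obtain rfl : x' = x := by simpa using hx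
    obtain _ | ⟨b, T⟩ := T
    · have := endsInCorner_singleton.1 hP.2.1
      omega
    obtain hN | hE := (List.isChain_cons_cons.1 hP.2.2).1
    · refine ⟨x', by simp, fun hxF => absurd (hFrow _ hxF) (lt_irrefl _), ?_⟩
      have hx2 : (x'.1.2 : ℕ) = x'.1.1 + 1 := by
        obtain ⟨⟨y, hy, hy'⟩, -⟩ := hP
        obtain rfl : x' = y := by simpa using hy
        exact hy'
      have hN1 := hN.1
      have hN2 : (b.1.2 : ℕ) = x'.1.2 := by rw [hN.2]
      have hle := x'.snd_le
      -- If `P` begins with a north step, its start `(i, i + 1)` is replaced by `(i - 1, i)`,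
      -- followed by an east step to the same second vertex.
      refine ⟨mk (x'.1.1 - 1) x'.1.1 (by omega) (by omega) :: b :: T, ⟨⟨_, rfl, ?_⟩, ?_, ?_⟩,
        Or.inl ⟨_, rfl, _, rfl, ?_⟩, ?_⟩
      · rw [mk_fst, mk_snd]
        omega
      · exact endsInCorner_cons_cons.2 (endsInCorner_cons_cons.1 hP.2.1)
      · exact List.isChain_cons_cons.2 ⟨Or.inr ⟨Fin.ext (by rw [mk_fst]; omega), by rw [mk_snd]; omega⟩,
          (List.isChain_cons_cons.1 hP.2.2).2⟩
      · rw [Fin.lt_def, mk_fst]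
        omega
      · exact erase_toFinset_subset (L := []) _ _
    · obtain ⟨l, a, u, b', T', h1, h2, h3, h4, -⟩ := exists_turn hE hP.2.2 hP.2.1 (by omega)
      rw [h1] at hP ⊢
      refine ⟨u, by simp, fun huF => ?_, exists_exchange_of_turn hP h2 h3⟩
      have := hFrow u huF
      omega
  · have hN1 := hN.1
    obtain ⟨l', a, u, b, T, h1, h2, h3, h4, h5⟩ := exists_turn hE
      (List.isChain_append.1 hP.2.2).2.1 (endsInCorner_append_cons.1 hP.2.1) (by omega)
    rw [h1, ← List.append_assoc] at hP ⊢
    refine ⟨u, by simp, fun huF => ?_, exists_exchange_of_turn hP h2 h3⟩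
    have hpw := pairwise_of_isChain_latticeStep hF.2.2
    rw [List.pairwise_append, List.pairwise_cons, List.pairwise_cons] at hpw
    obtain ⟨-, ⟨-, hp, -⟩, hl⟩ := hpw
    simp only [List.mem_append, List.mem_cons] at huF
    obtain hu | rfl | rfl | hu := huF
    · have := (hl u hu v (by simp)).2.1
      omega
    · omega
    · omega
    · have := (hp u hu).1
      omega

theorem NorthStep.not_eastStep {p q : UpperPos n} (h : NorthStep p q) : ¬ EastStep p q := by
  intro h'
  have h1 := h'.2
  rw [h.2] at h1
  omega

/-- Two lists diverge at only one place, where one step cannot be both north and east. -/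
theorem PathPrecedes.asymm {P Q : List (UpperPos n)} (h : PathPrecedes P Q) :
    ¬ PathPrecedes Q P := by
  have hhead : ∀ {l : List (UpperPos n)} {v p q : UpperPos n} {P' Q' : List (UpperPos n)},
      (l ++ v :: p :: P').head? = (l ++ v :: q :: Q').head? := by
    intro l _ _ _ _ _
    cases l <;> rfl
  intro h'
  obtain ⟨p, hp, q, hq, hlt⟩ | ⟨l, v, p, q, P', Q', rfl, rfl, hN, hE⟩ := h
  · obtain ⟨q', hq', p', hp', hlt'⟩ | ⟨l, v, p', q', P', Q', rfl, rfl, hN, hE⟩ := h'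
    · rw [Option.mem_unique hp hp', Option.mem_unique hq hq'] at hlt
      exact lt_asymm hlt hlt'
    · rw [hhead] at hp
      rw [Option.mem_unique hp hq] at hlt
      exact lt_irrefl _ hlt
  · obtain ⟨q', hq', p', hp', hlt'⟩ | ⟨l', v', p', q', P'', Q'', h1, h2, hN', hE'⟩ := h'
    · rw [hhead] at hp'
      rw [Option.mem_unique hp' hq'] at hlt'
      exact lt_irrefl _ hlt'
    · induction l generalizing l' with
      | nil =>
        obtain _ | ⟨c, l'⟩ := l'
        · simp only [List.nil_append, List.cons.injEq] at h1 h2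
          obtain ⟨rfl, rfl, -⟩ := h1
          exact hN'.not_eastStep hE
        · simp only [List.nil_append, List.cons_append, List.cons.injEq] at h1 h2
          have : p = q := by
            have h3 := congrArg List.head? h1.2
            have h4 := congrArg List.head? h2.2
            rw [hhead (p := p') (q := q') (Q' := Q''), ← h4] at h3
            simpa using h3.symm
          subst this
          exact hN.not_eastStep hE
      | cons c l ih =>
        obtain _ | ⟨c', l'⟩ := l'
        · simp only [List.nil_append, List.cons_append, List.cons.injEq] at h1 h2
          have : p' = q' := by
            have h3 := congrArg List.head? h1.2
            have h4 := congrArg List.head? h2.2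
            rw [hhead (p := q) (q := p) (Q' := P'), h4] at h3
            simpa using h3.symm
          subst this
          exact hN'.not_eastStep hE'
        · simp only [List.cons_append, List.cons.injEq] at h1 h2
          exact ih l' h1.2 h2.2

/-- The vertices of `P` whose removal leaves a face of a preceding path. -/
noncomputable def restriction (P : List (UpperPos n)) : Finset (UpperPos n) :=
  open Classical in P.toFinset.filter fun v =>
    ∃ Q, IsLatticePath Q ∧ PathPrecedes Q P ∧ P.toFinset.erase v ⊆ Q.toFinset

theorem isShelling_latticePaths (hn : 1 ≤ n) :
    IsShelling (intervalComplex n) ((latticePaths n).map List.toFinset) := by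
  classical
  refine ⟨fun F G hF hG => by rw [hF.card_intervalComplex hn, hG.card_intervalComplex hn], ?_, ?_,
    ?_⟩
  -- The exchange vertex also separates the vertex sets of two different paths.
  · rw [List.Nodup, List.pairwise_map]
    refine pairwise_latticePaths.imp_of_mem fun {F P} hF hP h heq => ?_
    obtain ⟨u, hu, hu', -⟩ := h.exists_exchange (mem_latticePaths.1 hF) (mem_latticePaths.1 hP)
    rw [← List.mem_toFinset, heq, List.mem_toFinset] at hu'
    exact hu' hu
  · intro F
    simp [isFacet_intervalComplex_iff hn, mem_latticePaths]
  · intro k hk h0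
    rw [List.length_map] at hk
    have hP : IsLatticePath (latticePaths n)[k] := mem_latticePaths.1 (List.getElem_mem hk)
    have hpre : ∀ F, F ∈ ((latticePaths n).map List.toFinset).take k ↔
        ∃ Q, IsLatticePath Q ∧ PathPrecedes Q (latticePaths n)[k] ∧ Q.toFinset = F := by
      intro F
      rw [← List.map_take, List.mem_map]
      constructor
      · rintro ⟨Q, hQ, rfl⟩
        obtain ⟨i, hi, rfl⟩ := List.mem_take_iff_getElem.1 hQ
        refine ⟨_, mem_latticePaths.1 (List.getElem_mem _), ?_, rfl⟩
        exact List.pairwise_iff_getElem.1 pairwise_latticePaths i k _ hk (by omega)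
      · rintro ⟨Q, hQ, hQP, rfl⟩
        obtain ⟨i, hi, rfl⟩ := List.getElem_of_mem (mem_latticePaths.2 hQ)
        refine ⟨_, List.mem_take_iff_getElem.2 ⟨i, ?_, rfl⟩, rfl⟩
        have : i < k := by
          by_contra hik
          obtain rfl | hik := (not_lt.1 hik).eq_or_lt
          · exact hQP.asymm hQP
          · exact hQP.asymm (List.pairwise_iff_getElem.1 pairwise_latticePaths k i hk hi hik)
        omega
    have hex : ∀ F, F ∈ ((latticePaths n).map List.toFinset).take k →
        ∃ v ∈ restriction (latticePaths n)[k], v ∉ F := by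
      intro F hF
      obtain ⟨Q, hQ, hQP, rfl⟩ := (hpre F).1 hF
      obtain ⟨u, hu, huQ, hu'⟩ := hQP.exists_exchange hQ hP
      exact ⟨u, by simp [restriction, hu, hu'], by simpa using huQ⟩
    refine ⟨restriction (latticePaths n)[k], ?_, ?_, ?_⟩
    · have h0k : 0 < (((latticePaths n).map List.toFinset).take k).length := by
        rw [List.length_take, List.length_map]
        omega
      obtain ⟨v, hv, -⟩ := hex _ (List.getElem_mem h0k)
      exact ⟨v, hv⟩
    · rw [List.getElem_map]
      exact Finset.filter_subset _ _
    · intro G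
      rw [List.getElem_map]
      constructor
      · rintro ⟨hG, F, hF, hGF⟩
        obtain ⟨v, hv, hvF⟩ := hex F hF
        exact ⟨v, hv, Finset.subset_erase.2 ⟨hG, fun h => hvF (hGF h)⟩⟩
      · rintro ⟨v, hv, hG⟩
        obtain ⟨-, Q, hQ, hQP, hsub⟩ := Finset.mem_filter.1 hv
        exact ⟨hG.trans (Finset.erase_subset _ _), Q.toFinset, (hpre _).2 ⟨Q, hQ, hQP, rfl⟩,
          hG.trans hsub⟩

end Shelling

/-! ### From a shelling to a ranked partition -/

/-- A face of `L[k]` lies in an earlier facet exactly when it misses a vertex of `A k`. So each face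
belongs to the interval from `A k` to `L[k]` for the first facet `L[k]` that contains it. -/
theorem IsShelling.exists_rankedPartition {σ : Type*} [DecidableEq σ] [Finite σ]
    {Δ : LowerSet (Finset σ)} {L : List (Finset σ)} (h : IsShelling Δ L) {n : ℕ} {ρ : σ → Fin n}
    (hρ : ∀ F, IsFacet Δ F → Set.BijOn ρ F Set.univ) :
    Nonempty (RankedPartition Δ ρ L.length) := by
  classical
  obtain ⟨-, -, hmem, hsh⟩ := h
  have hfacet : ∀ k : Fin L.length, IsFacet Δ L[k] := fun k => (hmem _).1 (List.getElem_mem k.2)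
  have hbot : ∀ k : Fin L.length, ∃ A : Finset σ, A ⊆ L[k] ∧
      ∀ G ⊆ L[k], (∃ j < k, G ⊆ L[j]) ↔ ∃ v ∈ A, v ∉ G := by
    intro k
    have htake : ∀ G, (∃ F ∈ L.take k, G ⊆ F) ↔ ∃ j < k, G ⊆ L[j] := by
      intro G
      constructor
      · rintro ⟨F, hF, hG⟩
        obtain ⟨i, hi, rfl⟩ := List.mem_take_iff_getElem.1 hF
        exact ⟨⟨i, by omega⟩, Fin.lt_def.2 (by simp only; omega), hG⟩
      · rintro ⟨j, hj, hG⟩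
        exact ⟨_, List.mem_take_iff_getElem.2 ⟨j, by have := Fin.lt_def.1 hj; omega, rfl⟩, hG⟩
    obtain h0 | h0 := Nat.eq_zero_or_pos (k : ℕ)
    -- The shelling condition says nothing about the first facet; its minimal face is empty.
    · refine ⟨∅, by simp, fun G _ => ⟨fun ⟨j, hj, _⟩ => ?_, by simp⟩⟩
      have := Fin.lt_def.1 hj
      omega
    · obtain ⟨A, -, hA, hG⟩ := hsh k k.2 h0
      refine ⟨A, hA, fun G hGk => ?_⟩
      rw [← htake]
      have := hG G
      constructor
      · intro h'
        obtain ⟨v, hv, hGv⟩ := this.1 ⟨hGk, h'⟩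
        exact ⟨v, hv, (Finset.subset_erase.1 hGv).2⟩
      · rintro ⟨v, hv, hGv⟩
        exact (this.2 ⟨v, hv, Finset.subset_erase.2 ⟨hGk, hGv⟩⟩).2
  choose A hA hG using hbot
  have hbij := fun k => hρ _ (hfacet k)
  choose s hs hs' using fun k r => (hbij k).surjOn (Set.mem_univ r)
  refine ⟨⟨A, fun k => L[k], s, fun k => (hfacet k).1, hA, ?_, ?_, hs, hs', fun k v hv =>
    (hbij k).injOn (hs k _) hv (hs' k _)⟩⟩
  · intro j k hjk
    by_contra hlt
    obtain ⟨v, hv, hv'⟩ := (hG k (A k) (hA k)).1 ⟨j, not_le.1 hlt, hjk⟩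
    exact hv' hv
  · intro S hS
    obtain ⟨F, hSF, hF⟩ := (Set.toFinite {S | S ∈ Δ}).exists_le_maximal hS
    obtain ⟨i, hi, rfl⟩ := List.getElem_of_mem ((hmem F).2 hF)
    obtain ⟨k, hk⟩ : ∃ k : Fin L.length, Minimal (fun k : Fin L.length => S ⊆ L[k]) k :=
      Set.Finite.exists_minimal (Set.toFinite {k : Fin L.length | S ⊆ L[k]}) ⟨⟨i, hi⟩, hSF⟩
    refine ⟨k, ?_, hk.1⟩
    by_contra hn
    obtain ⟨v, hv, hvS⟩ := Finset.not_subset.1 hn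
    obtain ⟨j, hj, hSj⟩ := (hG k S hk.1).2 ⟨v, hv, hvS⟩
    exact absurd (hk.2 hSj hj.le) (not_le.2 hj)

open UpperPos in
/-- The rank of an interval in the poset of intervals. -/
def UpperPos.rank {n : ℕ} (p : UpperPos n) : Fin n :=
  ⟨p.len - 1, by have := p.len_pos; have := p.len_le; omega⟩

theorem bijOn_rank {n : ℕ} (hn : 1 ≤ n) {F : Finset (UpperPos n)}
    (hF : IsFacet (intervalComplex n) F) :
    Set.BijOn UpperPos.rank (F : Set (UpperPos n)) Set.univ := by
  refine ⟨fun _ _ => Set.mem_univ _, fun p hp q hq h => ?_, fun r _ => ?_⟩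
  · have h' := congrArg Fin.val h
    have := p.len_pos
    have := q.len_pos
    simp only [UpperPos.rank] at h'
    exact UpperPos.eq_of_isChain_of_len_eq hF.1 hp hq (by omega)
  · obtain ⟨P, hP, rfl⟩ := (isFacet_intervalComplex_iff hn).1 hF
    have := r.2
    obtain ⟨u, hu, hr⟩ := hP.exists_mem_len_eq (d := r + 1) (by omega) (by omega)
    exact ⟨u, hu, Fin.ext (by simp [UpperPos.rank, hr])⟩

/-! ### Exponents with given row and column degrees -/

section Exponents

open UpperPos

variable {n : ℕ}

theorem UpperPos.len_rank {p : UpperPos n} : (p.rank : ℕ) + 1 = p.len := by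
  have := p.len_pos
  simp only [rank]
  omega

theorem exists_crossing_of_notMem {S : Finset (UpperPos n)} (hS : S ∉ intervalComplex n) :
    ∃ p ∈ S, ∃ q ∈ S, (p.1.1 : ℕ) < q.1.1 ∧ (p.1.2 : ℕ) < q.1.2 := by
  by_contra! h
  refine hS fun p hp q hq _ => ?_
  change IntervalLE p q ∨ IntervalLE q p
  have h1 := h p hp q hq
  have h2 := h q hq p hp
  rw [intervalLE_iff, intervalLE_iff]
  omega

theorem upperLabel_lt_of_len_lt {p q : UpperPos n} (h : p.len < q.len) :
    upperLabel n p < upperLabel n q := by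
  set g : ℕ → ℕ := fun d => (2 * n + 2 - d) * (d - 1) / 2 with hg
  have hstep : ∀ d, 1 ≤ d → d ≤ n → g (d + 1) = g d + (n + 1 - d) := by
    intro d h1 h2
    obtain ⟨e, rfl⟩ : ∃ e, d = e + 1 := ⟨d - 1, by omega⟩
    obtain ⟨m, rfl⟩ : ∃ m, n = e + 1 + m := ⟨n - (e + 1), by omega⟩
    -- `g d` counts the intervals shorter than `d`, and there are `n + 1 - d` of length `d`. The
    -- numerators differ by an even number, so the division by 2 loses nothing.
    have h3 : (2 * (e + 1 + m) + 2 - (e + 1 + 1)) * (e + 1 + 1 - 1) =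
        (2 * (e + 1 + m) + 2 - (e + 1)) * (e + 1 - 1) + 2 * (e + 1 + m + 1 - (e + 1)) := by
      have e1 : 2 * (e + 1 + m) + 2 - (e + 1 + 1) = e + 2 * m + 2 := by omega
      have e2 : 2 * (e + 1 + m) + 2 - (e + 1) = e + 2 * m + 3 := by omega
      have e3 : e + 1 + m + 1 - (e + 1) = m + 1 := by omega
      have e4 : e + 1 + 1 - 1 = e + 1 := by omega
      have e5 : e + 1 - 1 = e := by omega
      rw [e1, e2, e3, e4, e5]
      ring
    simp only [hg]
    rw [h3, Nat.add_mul_div_left _ _ (by norm_num)]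
  have hmono : ∀ d d', 1 ≤ d → d < d' → d' ≤ n → g d + (n + 1 - d) ≤ g d' := by
    intro d d' h1 h2 h3
    induction d', h2 using Nat.le_induction with
    | base => exact (hstep d h1 (by omega)).ge
    | succ e he ih => exact (ih (by omega)).trans (by rw [hstep e (by omega) (by omega)]; omega)
  have h1 := hmono p.len q.len p.len_pos h q.len_le
  have h2 := p.len_pos
  have h3 := p.fst_lt_snd
  have h4 := p.snd_le
  have e1 : upperLabel n p = g p.len + p.1.1 + 1 := rfl
  have e2 : upperLabel n q = g q.len + q.1.1 + 1 := rfl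
  rw [e1, e2]
  have : p.len = (p.1.2 : ℕ) - p.1.1 := rfl
  omega

/-- The exponents of the monomial in the entries of `u` and `v` that is obtained from a monomial
in the entries of the matrix `u vᵀ`. -/
noncomputable def margin (n : ℕ) : (UpperPos n →₀ ℕ) →+ (Fin (n + 1) ⊕ Fin (n + 1) →₀ ℕ) :=
  Finsupp.weight fun p => Finsupp.single (Sum.inl p.1.1) 1 + Finsupp.single (Sum.inr p.1.2) 1

theorem margin_single (p : UpperPos n) : margin n (Finsupp.single p 1) =
    Finsupp.single (Sum.inl p.1.1) 1 + Finsupp.single (Sum.inr p.1.2) 1 := by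
  simp [margin, Finsupp.weight_single]

theorem weight_margin (f : Fin (n + 1) ⊕ Fin (n + 1) → ℕ) (a : UpperPos n →₀ ℕ) :
    Finsupp.weight f (margin n a) =
      Finsupp.weight (fun p : UpperPos n => f (Sum.inl p.1.1) + f (Sum.inr p.1.2)) a := by
  suffices (Finsupp.weight f).comp (margin n) =
      Finsupp.weight (fun p : UpperPos n => f (Sum.inl p.1.1) + f (Sum.inr p.1.2)) from
    DFunLike.congr_fun this a
  refine Finsupp.addHom_ext' fun p => AddMonoidHom.ext_nat ?_
  simp [margin_single, Finsupp.weight_single]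

/-- The number of variables of the monomial `x ^ a`, with multiplicities, whose positions satisfy
`P`. -/
noncomputable def countWith (P : UpperPos n → Prop) [DecidablePred P] (a : UpperPos n →₀ ℕ) : ℕ :=
  ∑ p, if P p then a p else 0

theorem countWith_eq_weight (P : UpperPos n → Prop) [DecidablePred P] (a : UpperPos n →₀ ℕ) :
    countWith P a = Finsupp.weight (fun p => if P p then 1 else 0) a := by
  rw [Finsupp.weight_apply, Finsupp.sum_fintype _ _ (by simp)]
  simp [countWith]

theorem countWith_row_eq {a b : UpperPos n →₀ ℕ} (h : margin n b = margin n a) (i : ℕ) :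
    countWith (fun p => (p.1.1 : ℕ) ≤ i) b = countWith (fun p => (p.1.1 : ℕ) ≤ i) a := by
  have := congrArg (Finsupp.weight (Sum.elim (fun k : Fin (n + 1) => if (k : ℕ) ≤ i then 1 else 0)
    fun _ => (0 : ℕ))) h
  simpa [weight_margin, countWith_eq_weight] using this

theorem countWith_col_eq {a b : UpperPos n →₀ ℕ} (h : margin n b = margin n a) (j : ℕ) :
    countWith (fun p => j ≤ (p.1.2 : ℕ)) b = countWith (fun p => j ≤ (p.1.2 : ℕ)) a := by
  have := congrArg (Finsupp.weight (Sum.elim (fun _ => (0 : ℕ))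
    fun k : Fin (n + 1) => if j ≤ (k : ℕ) then 1 else 0)) h
  simpa [weight_margin, countWith_eq_weight] using this

theorem degree_eq_of_margin_eq {a b : UpperPos n →₀ ℕ} (h : margin n b = margin n a) :
    b.degree = a.degree := by
  have := congrArg (Finsupp.weight (Sum.elim (fun _ => (1 : ℕ))
    fun _ : Fin (n + 1) => 0)) h
  simpa [weight_margin, Finsupp.degree_eq_weight_one] using this

/-- In a chain, one of the conditions `p.1.1 ≤ i` and `j ≤ p.1.2` implies the other. The count for
`a` is thus a whole row count or column count, which is shared with `b` and bounds the count for
`b`. -/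
theorem countWith_and_le_of_margin_eq {a b : UpperPos n →₀ ℕ} (ha : a.support ∈ intervalComplex n)
    (h : margin n b = margin n a) (i j : ℕ) :
    countWith (fun p => (p.1.1 : ℕ) ≤ i ∧ j ≤ (p.1.2 : ℕ)) b ≤
      countWith (fun p => (p.1.1 : ℕ) ≤ i ∧ j ≤ (p.1.2 : ℕ)) a := by
  by_cases hrow : ∀ p ∈ a.support, (p.1.1 : ℕ) ≤ i → j ≤ (p.1.2 : ℕ)
  · calc countWith (fun p => (p.1.1 : ℕ) ≤ i ∧ j ≤ (p.1.2 : ℕ)) b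
        ≤ countWith (fun p => (p.1.1 : ℕ) ≤ i) b :=
          Finset.sum_le_sum fun p _ => by split_ifs <;> omega
      _ = countWith (fun p => (p.1.1 : ℕ) ≤ i) a := countWith_row_eq h i
      _ ≤ _ := Finset.sum_le_sum fun p _ => by
          by_cases hp : p ∈ a.support
          · have := hrow p hp
            split_ifs <;> omega
          · simp [Finsupp.notMem_support_iff.1 hp]
  · by_cases hcol : ∀ p ∈ a.support, j ≤ (p.1.2 : ℕ) → (p.1.1 : ℕ) ≤ i
    · calc countWith (fun p => (p.1.1 : ℕ) ≤ i ∧ j ≤ (p.1.2 : ℕ)) b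
          ≤ countWith (fun p => j ≤ (p.1.2 : ℕ)) b :=
            Finset.sum_le_sum fun p _ => by split_ifs <;> omega
        _ = countWith (fun p => j ≤ (p.1.2 : ℕ)) a := countWith_col_eq h j
        _ ≤ _ := Finset.sum_le_sum fun p _ => by
            by_cases hp : p ∈ a.support
            · have := hcol p hp
              split_ifs <;> omega
            · simp [Finsupp.notMem_support_iff.1 hp]
    · exfalso
      push Not at hrow hcol
      obtain ⟨p, hp, hp1, hp2⟩ := hrow
      obtain ⟨q, hq, hq1, hq2⟩ := hcol
      have hne : p ≠ q := by
        rintro rfl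
        omega
      have : IntervalLE p q ∨ IntervalLE q p := ha hp hq hne
      rw [intervalLE_iff, intervalLE_iff] at this
      omega

/-- Among the intervals that contain `s`, all but `s` are longer, so there the exponents agree and
the inequality of counts reduces to the one at `s`. -/
theorem le_of_margin_eq {a b : UpperPos n →₀ ℕ} (ha : a.support ∈ intervalComplex n)
    (h : margin n b = margin n a) (s : UpperPos n) (hs : ∀ t, s.len < t.len → a t = b t) :
    b s ≤ a s := by
  have key := countWith_and_le_of_margin_eq ha h s.1.1 s.1.2
  unfold countWith at key
  rw [← Finset.add_sum_erase _ _ (Finset.mem_univ s),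
    ← Finset.add_sum_erase _ (fun p : UpperPos n => if (p.1.1 : ℕ) ≤ s.1.1 ∧ (s.1.2 : ℕ) ≤ p.1.2 then
      a p else 0) (Finset.mem_univ s)] at key
  have : ∑ x ∈ Finset.univ.erase s, (if (x.1.1 : ℕ) ≤ s.1.1 ∧ (s.1.2 : ℕ) ≤ x.1.2 then b x else 0) =
      ∑ x ∈ Finset.univ.erase s, if (x.1.1 : ℕ) ≤ s.1.1 ∧ (s.1.2 : ℕ) ≤ x.1.2 then a x else 0 := by
    refine Finset.sum_congr rfl fun t ht => ?_
    split_ifs with h'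
    · refine (hs t ?_).symm
      have hne : ¬ ((t.1.1 : ℕ) = s.1.1 ∧ (t.1.2 : ℕ) = s.1.2) := fun h =>
        Finset.ne_of_mem_erase ht (ext_nat h.1 h.2)
      have := s.fst_lt_snd
      unfold len
      omega
    · rfl
  rw [this] at key
  simpa using key

theorem eq_of_margin_eq {a b : UpperPos n →₀ ℕ} (ha : a.support ∈ intervalComplex n)
    (hb : b.support ∈ intervalComplex n) (h : margin n b = margin n a) : b = a := by
  by_contra hne
  obtain ⟨t, ht⟩ := Finsupp.ne_iff.1 hne
  obtain ⟨s, hs, hmax⟩ := Finset.exists_max_image (Finset.univ.filter fun s => b s ≠ a s) len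
    ⟨t, by simpa using ht⟩
  have hag : ∀ t, s.len < t.len → a t = b t := by
    intro t ht
    by_contra h'
    exact absurd (hmax t (by simpa using Ne.symm h')) (not_le.2 ht)
  refine (Finset.mem_filter.1 hs).2 (le_antisymm (le_of_margin_eq ha h s hag) ?_)
  exact le_of_margin_eq hb h.symm s fun t ht => (hag t ht).symm

/-- Longer intervals have larger labels, so at the last difference `s` all longer intervals agree.
-/
theorem not_degRevLexGT_of_margin_eq {a b : UpperPos n →₀ ℕ} (ha : a.support ∈ intervalComplex n)
    (h : margin n b = margin n a) : ¬ DegRevLexGT (upperLabel n) a b := by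
  rintro (h' | ⟨-, s, hs, hag⟩)
  · rw [degree_eq_of_margin_eq h] at h'
    exact lt_irrefl _ h'
  · exact absurd (le_of_margin_eq ha h s fun t ht => hag t (upperLabel_lt_of_len_lt ht))
      (not_le.2 hs)

end Exponents

/-! ### Rank-one matrices and the minimal orbit -/

section Orbit

variable {n : ℕ}

theorem vecMulVec_mem_minNilpotentOrbit (hn : 1 ≤ n) {u v : Fin (n + 1) → ℂ} (hu : u 0 ≠ 0)
    (hv : v (Fin.last n) ≠ 0) (huv : ∑ i, v i * u i = 0) :
    Matrix.vecMulVec u v ∈ minNilpotentOrbit n := by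
  -- The columns of `g` are `s u`, then the vectors `e_j - (v_j / v_n) e_n` annihilated by `v`, and
  -- `(s / v_n) e_n`. Thus `vᵀ g = s e_nᵀ`, and `det g = s² u_0 / v_n`, which dictates `s`.
  obtain ⟨s, hs⟩ := IsAlgClosed.exists_pow_nat_eq (v (Fin.last n) / u 0) (n := 2) (by norm_num)
  have h0l : (0 : Fin (n + 1)) ≠ Fin.last n := by
    rw [Ne, Fin.ext_iff, Fin.val_zero, Fin.val_last]
    omega
  let g : Matrix (Fin (n + 1)) (Fin (n + 1)) ℂ := Matrix.of fun i j =>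
    if j = 0 then s * u i else if j = Fin.last n then (if i = Fin.last n then s / v (Fin.last n) else 0)
    else if i = j then 1 else if i = Fin.last n then - v j / v (Fin.last n) else 0
  have hdet : g.det = 1 := by
    rw [Matrix.det_of_isLowerTriangular]
    · have : ∀ i, g i i = (if i = 0 then s * u 0 else 1) *
          (if i = Fin.last n then s / v (Fin.last n) else 1) := by
        intro i
        simp only [g, Matrix.of_apply]
        split_ifs with h1 h2 h2
        · exact absurd (h1.symm.trans h2) h0l
        · rw [h1, mul_one]
        · rw [one_mul]
        · rw [one_mul]
      simp only [this, Finset.prod_mul_distrib, Finset.prod_ite_eq', Finset.mem_univ, if_true]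
      have : s * u 0 * (s / v (Fin.last n)) = s ^ 2 * u 0 / v (Fin.last n) := by ring
      rw [this, hs]
      field_simp
    · intro i j hij
      have hij : i < j := hij
      have hj0 : j ≠ 0 := (lt_of_le_of_lt (Fin.zero_le i) hij).ne'
      have hil : i ≠ Fin.last n := (lt_of_lt_of_le hij (Fin.le_last j)).ne
      simp [g, hj0, hil, hij.ne]
  have hmul : Matrix.vecMulVec u v * g = g * Matrix.single 0 (Fin.last n) 1 := by
    rw [Matrix.vecMulVec_mul]
    ext i j
    rw [Matrix.vecMulVec_apply]
    have hj : Matrix.vecMul v g j = if j = Fin.last n then s else 0 := by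
      simp only [Matrix.vecMul, dotProduct, g, Matrix.of_apply]
      by_cases h1 : j = 0
      · rw [h1, if_neg h0l]
        simp only [if_true]
        rw [← mul_zero s, ← huv, Finset.mul_sum]
        exact Finset.sum_congr rfl fun i _ => by ring
      · simp only [h1, if_false]
        by_cases h2 : j = Fin.last n
        · simp [h2, mul_div_cancel₀ _ hv]
        · simp only [h2, if_false]
          rw [Fintype.sum_eq_add j (Fin.last n) h2]
          · simp only [if_true, if_neg (Ne.symm h2)]
            field_simp
            ring
          · rintro i ⟨hi1, hi2⟩
            simp [hi1, hi2]
    rw [hj]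
    by_cases h : j = Fin.last n
    · rw [h, Matrix.mul_single_apply_same]
      simp [g, mul_comm]
    · rw [Matrix.mul_single_apply_of_ne _ _ _ _ _ h]
      simp [h]
  obtain ⟨G, hG⟩ : ∃ G : Matrix.SpecialLinearGroup (Fin (n + 1)) ℂ,
    (G : Matrix (Fin (n + 1)) (Fin (n + 1)) ℂ) = g := ⟨⟨g, hdet⟩, rfl⟩
  refine ⟨G, ?_⟩
  rw [hG, ← hmul, Matrix.mul_assoc, ← hG, ← Matrix.SpecialLinearGroup.coe_mul, mul_inv_cancel,
    Matrix.SpecialLinearGroup.coe_one, Matrix.mul_one]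

theorem minor_eq_of_mem_closure {A : Matrix (Fin (n + 1)) (Fin (n + 1)) ℂ}
    (hA : A ∈ closure (minNilpotentOrbit n)) (i k j l : Fin (n + 1)) :
    A i j * A k l = A i l * A k j := by
  have hclosed : IsClosed {A : Matrix (Fin (n + 1)) (Fin (n + 1)) ℂ |
      A i j * A k l = A i l * A k j} := by
    refine isClosed_eq ?_ ?_ <;>
      exact (continuous_id.matrix_elem _ _).mul (continuous_id.matrix_elem _ _)
  refine closure_minimal ?_ hclosed hA
  rintro _ ⟨g, rfl⟩
  have : ∀ x y, ((g : Matrix (Fin (n + 1)) (Fin (n + 1)) ℂ) * Matrix.single 0 (Fin.last n) 1 *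
      ((g⁻¹ : Matrix.SpecialLinearGroup (Fin (n + 1)) ℂ) : Matrix (Fin (n + 1)) (Fin (n + 1)) ℂ) :
      Matrix (Fin (n + 1)) (Fin (n + 1)) ℂ) x y =
      (g : Matrix (Fin (n + 1)) (Fin (n + 1)) ℂ) x 0 *
      ((g⁻¹ : Matrix.SpecialLinearGroup (Fin (n + 1)) ℂ) : Matrix (Fin (n + 1)) (Fin (n + 1)) ℂ)
        (Fin.last n) y := by
    intro x y
    rw [Matrix.mul_apply, Finset.sum_eq_single (Fin.last n)]
    · rw [Matrix.mul_single_apply_same, mul_one]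
    · intro z _ hz
      rw [Matrix.mul_single_apply_of_ne _ _ _ _ _ hz, zero_mul]
    · simp
  simp only [Set.mem_ofPred_eq, this]
  ring

end Orbit

/-! ### Straightening, the ideal as an intersection of kernels, and its initial ideal -/

section Ideals

open UpperPos MvPolynomial

variable {n : ℕ}

/-- The value of the coordinate `(i, j)` in the coordinate ring of `𝔫⁺`: zero if `j ≤ i`. -/
noncomputable def upperEntry (i j : Fin (n + 1)) : MvPolynomial (UpperPos n) ℂ :=
  restrictToUpper n (X (i, j))

theorem upperEntry_of_lt (p : UpperPos n) : upperEntry p.1.1 p.1.2 = X p := by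
  rw [upperEntry, restrictToUpper, aeval_X, dif_pos p.2]

theorem upperEntry_of_le {i j : Fin (n + 1)} (h : j ≤ i) : upperEntry i j = 0 := by
  rw [upperEntry, restrictToUpper, aeval_X, dif_neg (not_lt.2 h)]

theorem minor_mem_intersectionIdeal (i k j l : Fin (n + 1)) :
    upperEntry i j * upperEntry k l - upperEntry i l * upperEntry k j ∈ intersectionIdeal n := by
  have : (X (i, j) * X (k, l) - X (i, l) * X (k, j) :
      MvPolynomial (Fin (n + 1) × Fin (n + 1)) ℂ) ∈ minOrbitClosureIdeal n := by
    rw [minOrbitClosureIdeal, mem_vanishingIdeal_iff]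
    intro x hx
    have := minor_eq_of_mem_closure hx i k j l
    simpa [sub_eq_zero] using this
  simpa [upperEntry, intersectionIdeal] using Ideal.mem_map_of_mem (restrictToUpper n) this

/-- The pullback of functions on `𝔫⁺` along `(u, v) ↦ u vᵀ`, where the entries of `u` after the
place `c` and those of `v` up to the place `c` are replaced by zero. -/
noncomputable def rankOneHom (n c : ℕ) :
    MvPolynomial (UpperPos n) ℂ →ₐ[ℂ] MvPolynomial (Fin (n + 1) ⊕ Fin (n + 1)) ℂ :=
  aeval fun p => if (p.1.1 : ℕ) ≤ c ∧ c < (p.1.2 : ℕ) then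
    X (Sum.inl p.1.1) * X (Sum.inr p.1.2) else 0

open Classical in
theorem rankOneHom_monomial (c : ℕ) (a : UpperPos n →₀ ℕ) (r : ℂ) :
    rankOneHom n c (monomial a r) =
      if ∀ p ∈ a.support, (p.1.1 : ℕ) ≤ c ∧ c < (p.1.2 : ℕ) then monomial (margin n a) r else 0 := by
  rw [rankOneHom, aeval_monomial]
  split_ifs with h
  · rw [margin, Finsupp.weight_apply, monomial_finsupp_sum_index]
    congr 1
    refine Finset.prod_congr rfl fun p hp => ?_
    simp only
    rw [if_pos (h p hp), X, X, monomial_mul, monomial_pow]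
    simp
  · push Not at h
    obtain ⟨p, hp, h⟩ := h
    rw [Finsupp.prod, Finset.prod_eq_zero hp, mul_zero]
    rw [if_neg (by omega), zero_pow (Finsupp.mem_support_iff.1 hp)]

theorem rankOneHom_eq_zero_of_mem (hn : 1 ≤ n) {c : ℕ} (hc : c < n)
    {f : MvPolynomial (UpperPos n) ℂ} (hf : f ∈ intersectionIdeal n) : rankOneHom n c f = 0 := by
  suffices intersectionIdeal n ≤ RingHom.ker (rankOneHom n c) from this hf
  rw [intersectionIdeal, Ideal.map_le_iff_le_comap]
  intro g hg
  rw [Ideal.mem_comap, RingHom.mem_ker]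
  -- Only points with `u_0` and `v_n` nonzero are known to give orbit elements. The extra factor
  -- makes the product vanish everywhere, and it cancels in a domain.
  have : (X (Sum.inl 0) * X (Sum.inr (Fin.last n))) * rankOneHom n c (restrictToUpper n g) = 0 := by
    refine MvPolynomial.funext fun x => ?_
    rw [map_mul, map_zero, map_mul, eval_X, eval_X]
    by_cases hx : x (Sum.inl 0) = 0
    · simp [hx]
    by_cases hy : x (Sum.inr (Fin.last n)) = 0
    · simp [hy]
    set u : Fin (n + 1) → ℂ := fun i => if (i : ℕ) ≤ c then x (Sum.inl i) else 0 with hu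
    set v : Fin (n + 1) → ℂ := fun j => if c < (j : ℕ) then x (Sum.inr j) else 0 with hv
    have hmem : Matrix.vecMulVec u v ∈ minNilpotentOrbit n := by
      refine vecMulVec_mem_minNilpotentOrbit hn ?_ ?_ ?_
      · simpa [hu] using hx
      · simpa [hv, hc] using hy
      · refine Finset.sum_eq_zero fun i _ => ?_
        simp only [hu, hv]
        split_ifs <;> first | omega | simp
    have hg' := (mem_vanishingIdeal_iff.1 hg) (fun p => u p.1 * v p.2) (subset_closure hmem)
    have hcomp : (aeval x).comp ((rankOneHom n c).comp (restrictToUpper n)) =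
        (aeval (fun p : Fin (n + 1) × Fin (n + 1) => u p.1 * v p.2) :
          MvPolynomial (Fin (n + 1) × Fin (n + 1)) ℂ →ₐ[ℂ] ℂ) := by
      ext p
      simp only [AlgHom.comp_apply, restrictToUpper, aeval_X]
      by_cases h : p.1 < p.2
      · rw [dif_pos h, rankOneHom, aeval_X]
        simp only [hu, hv]
        split_ifs <;> first | omega | simp
      · have h' : ¬ ((p.1 : ℕ) < p.2) := h
        rw [dif_neg h]
        simp only [hu, hv, map_zero]
        split_ifs <;> first | omega | simp
    have := DFunLike.congr_fun hcomp g
    rw [hg'] at this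
    have h' : eval x (rankOneHom n c (restrictToUpper n g)) = 0 := by
      rw [← coe_aeval_eq_eval]
      exact this
    rw [h', mul_zero]
  exact (mul_eq_zero.1 this).resolve_left (mul_ne_zero (X_ne_zero _) (X_ne_zero _))

/-- For `c` the left end of the shortest interval of `a`, `rankOneHom n c` does not kill the
monomial of `a`, so another term of `f` must cancel its image. -/
theorem exists_margin_eq (hn : 1 ≤ n) {f : MvPolynomial (UpperPos n) ℂ}
    (hf : ∀ c < n, rankOneHom n c f = 0) {a : UpperPos n →₀ ℕ} (ha : a ∈ f.support)
    (hΔ : a.support ∈ intervalComplex n) : ∃ b ∈ f.support, b ≠ a ∧ margin n b = margin n a := by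
  classical
  obtain ⟨c, hc, hac⟩ : ∃ c < n, ∀ p ∈ a.support, (p.1.1 : ℕ) ≤ c ∧ c < (p.1.2 : ℕ) := by
    obtain h0 | hne := a.support.eq_empty_or_nonempty
    · exact ⟨0, hn, by simp [h0]⟩
    · obtain ⟨s, hs, hmin⟩ := Finset.exists_min_image _ len hne
      have h1 := s.fst_lt_snd
      have h2 := s.snd_le
      refine ⟨s.1.1, by omega, fun t ht => ?_⟩
      obtain rfl | hst := eq_or_ne s t
      · omega
      · have h3 := hmin t ht
        unfold len at h3
        have : IntervalLE s t ∨ IntervalLE t s := hΔ hs ht hst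
        rw [intervalLE_iff, intervalLE_iff] at this
        omega
  by_contra! h
  have h0 := congrArg (coeff (margin n a)) (hf c hc)
  rw [f.as_sum, map_sum, coeff_sum, Finset.sum_eq_single a] at h0
  · rw [rankOneHom_monomial, if_pos hac, coeff_monomial, if_pos rfl, coeff_zero] at h0
    exact mem_support_iff.1 ha h0
  · intro b hb hba
    rw [rankOneHom_monomial]
    split_ifs
    · rw [coeff_monomial, if_neg (h b hb hba)]
    · rfl
  · exact fun h => absurd ha h

theorem eq_zero_of_support_subset (hn : 1 ≤ n) {f : MvPolynomial (UpperPos n) ℂ}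
    (hf : ∀ c < n, rankOneHom n c f = 0) (hΔ : ∀ a ∈ f.support, a.support ∈ intervalComplex n) :
    f = 0 := by
  by_contra hne
  obtain ⟨a, ha⟩ := support_nonempty.2 hne
  obtain ⟨b, hb, hba, hm⟩ := exists_margin_eq hn hf ha (hΔ a ha)
  exact hba (eq_of_margin_eq (hΔ a ha) (hΔ b hb) hm)

/-- The interval `[p.1, q.2]` spanned by the crossing or disjoint intervals `p` and `q`. -/
def hull (p q : UpperPos n) (h : (p.1.1 : ℕ) < q.1.1) : UpperPos n :=
  ⟨(p.1.1, q.1.2), lt_trans (Fin.lt_def.2 h) q.2⟩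

/-- The interval `[q.1, p.2]` in which the crossing intervals `p` and `q` meet. -/
def overlap (p q : UpperPos n) (h : (q.1.1 : ℕ) < p.1.2) : UpperPos n := ⟨(q.1.1, p.1.2), h⟩

theorem X_mul_X_mem_of_disjoint {p q : UpperPos n} (h : (p.1.2 : ℕ) ≤ q.1.1) :
    (X p * X q : MvPolynomial (UpperPos n) ℂ) ∈ intersectionIdeal n := by
  have := minor_mem_intersectionIdeal p.1.1 q.1.1 p.1.2 q.1.2
  rwa [upperEntry_of_lt, upperEntry_of_lt, upperEntry_of_le (Fin.le_def.2 h), mul_zero,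
    sub_zero] at this

theorem X_mul_X_sub_mem_of_crossing {p q : UpperPos n} (h₁ : (p.1.1 : ℕ) < q.1.1)
    (h₂ : (q.1.1 : ℕ) < p.1.2) :
    (X p * X q - X (hull p q h₁) * X (overlap p q h₂) : MvPolynomial (UpperPos n) ℂ) ∈
      intersectionIdeal n := by
  have := minor_mem_intersectionIdeal p.1.1 q.1.1 p.1.2 q.1.2
  rw [← upperEntry_of_lt p, ← upperEntry_of_lt q, ← upperEntry_of_lt (hull p q h₁),
    ← upperEntry_of_lt (overlap p q h₂)]
  exact this

/-- A weight on ranks for which passing from crossing to nested intervals lowers the weight. -/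
def rankWeight (n : ℕ) (r : Fin n) : ℕ := n ^ 2 - ((r : ℕ) + 1) ^ 2

theorem rankWeight_hull_add_overlap_lt {p q : UpperPos n} (h₁ : (p.1.1 : ℕ) < q.1.1)
    (h₂ : (q.1.1 : ℕ) < p.1.2) (h₃ : (p.1.2 : ℕ) < q.1.2) :
    rankWeight n (hull p q h₁).rank + rankWeight n (overlap p q h₂).rank <
      rankWeight n p.rank + rankWeight n q.rank := by
  have hle : ∀ s : UpperPos n, s.len ^ 2 ≤ n ^ 2 := fun s => Nat.pow_le_pow_left s.len_le 2
  simp only [rankWeight, len_rank]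
  have e1 := hle p
  have e2 := hle q
  have e3 := hle (hull p q h₁)
  have e4 := hle (overlap p q h₂)
  -- With `A`, `C` the lengths of the parts of `p` and `q` outside the overlap, the right side
  -- exceeds the left by `2 A C`.
  have key : p.len ^ 2 + q.len ^ 2 < (hull p q h₁).len ^ 2 + (overlap p q h₂).len ^ 2 := by
    have f1 : p.len = (p.1.2 : ℕ) - p.1.1 := rfl
    have f2 : q.len = (q.1.2 : ℕ) - q.1.1 := rfl
    have f3 : (hull p q h₁).len = (q.1.2 : ℕ) - p.1.1 := rfl
    have f4 : (overlap p q h₂).len = (p.1.2 : ℕ) - q.1.1 := rfl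
    obtain ⟨x, hx⟩ : ∃ x, (q.1.1 : ℕ) = p.1.1 + (x + 1) := ⟨q.1.1 - p.1.1 - 1, by omega⟩
    obtain ⟨y, hy⟩ : ∃ y, (p.1.2 : ℕ) = q.1.1 + y := ⟨p.1.2 - q.1.1, by omega⟩
    obtain ⟨z, hz⟩ : ∃ z, (q.1.2 : ℕ) = p.1.2 + (z + 1) := ⟨q.1.2 - p.1.2 - 1, by omega⟩
    have g1 : p.len = x + 1 + y := by omega
    have g2 : q.len = y + z + 1 := by omega
    have g3 : (hull p q h₁).len = x + y + z + 2 := by omega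
    have g4 : (overlap p q h₂).len = y := by omega
    rw [g1, g2, g3, g4]
    nlinarith [Nat.zero_le (x * z)]
  omega

theorem straightens_intersectionIdeal :
    RankedPartition.Straightens (intersectionIdeal n) (rankWeight n) (intervalComplex n)
      UpperPos.rank := by
  intro a
  induction hw : Finsupp.weight (rankWeight n ∘ UpperPos.rank) a using Nat.strong_induction_on
    generalizing a with
  | _ w ih =>
    intro ha
    obtain ⟨p, hp, q, hq, hpq1, hpq2⟩ := exists_crossing_of_notMem ha
    have hne : p ≠ q := by
      rintro rfl
      omega
    obtain ⟨b, rfl⟩ : ∃ b, a = b + (Finsupp.single p 1 + Finsupp.single q 1) := by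
      refine ⟨a - (Finsupp.single p 1 + Finsupp.single q 1), (tsub_add_cancel_of_le ?_).symm⟩
      intro t
      rw [Finsupp.mem_support_iff] at hp hq
      simp only [Finsupp.add_apply, Finsupp.single_apply]
      split_ifs with h1 h2 h2
      · exact absurd (h1.trans h2.symm) hne
      · subst h1
        omega
      · subst h2
        omega
      · exact Nat.zero_le _
    have hmon : ∀ s t : UpperPos n, monomial (b + (Finsupp.single s 1 + Finsupp.single t 1)) (1 : ℂ) =
        monomial b 1 * (X s * X t) := by
      intro s t
      rw [X, X, monomial_mul, monomial_mul, one_mul, one_mul]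
    have hweight : ∀ s t : UpperPos n, Finsupp.weight (rankWeight n ∘ UpperPos.rank)
        (b + (Finsupp.single s 1 + Finsupp.single t 1)) =
        Finsupp.weight (rankWeight n ∘ UpperPos.rank) b +
          (rankWeight n s.rank + rankWeight n t.rank) := by
      intro s t
      simp [Finsupp.weight_single]
    by_cases h2 : (q.1.1 : ℕ) < p.1.2
    · have hmem := Ideal.mul_mem_left _ (monomial b 1) (X_mul_X_sub_mem_of_crossing hpq1 h2)
      rw [mul_sub, ← hmon, ← hmon] at hmem
      have hlt : Finsupp.weight (rankWeight n ∘ UpperPos.rank)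
          (b + (Finsupp.single (hull p q hpq1) 1 + Finsupp.single (overlap p q h2) 1)) < w := by
        rw [← hw, hweight, hweight]
        have := rankWeight_hull_add_overlap_lt hpq1 h2 hpq2
        omega
      by_cases hΔ : (b + (Finsupp.single (hull p q hpq1) 1 +
          Finsupp.single (overlap p q h2) 1)).support ∈ intervalComplex n
      · exact Or.inr ⟨_, hΔ, hmem, hlt⟩
      · obtain h | ⟨c, hc, h, hlt'⟩ := ih _ hlt _ rfl hΔ
        · exact Or.inl (by simpa using Ideal.add_mem _ hmem h)
        · exact Or.inr ⟨c, hc, by simpa using Ideal.add_mem _ hmem h, hlt'.trans hlt⟩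
    · left
      rw [hmon]
      exact Ideal.mul_mem_left _ _ (X_mul_X_mem_of_disjoint (not_lt.1 h2))

theorem exists_sub_mem (f : MvPolynomial (UpperPos n) ℂ) :
    ∃ g, (∀ a ∈ g.support, a.support ∈ intervalComplex n) ∧ f - g ∈ intersectionIdeal n := by
  induction f using MvPolynomial.induction_on' with
  | monomial a r =>
    by_cases ha : a.support ∈ intervalComplex n
    · refine ⟨monomial a r, fun b hb => ?_, by simp⟩
      rwa [Finset.mem_singleton.1 (support_monomial_subset hb)]
    · have hr : ∀ c : UpperPos n →₀ ℕ, monomial c r = C r * monomial c 1 := by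
        intro c
        rw [C_mul_monomial, mul_one]
      obtain h | ⟨c, hc, h, -⟩ := straightens_intersectionIdeal a ha
      · refine ⟨0, by simp, ?_⟩
        rw [sub_zero, hr]
        exact Ideal.mul_mem_left _ _ h
      · refine ⟨monomial c r, fun b hb => ?_, ?_⟩
        · rwa [Finset.mem_singleton.1 (support_monomial_subset hb)]
        · rw [hr, hr c, ← mul_sub]
          exact Ideal.mul_mem_left _ _ h
  | add p q hp hq =>
    classical
    obtain ⟨g, hg, hpg⟩ := hp
    obtain ⟨g', hg', hqg⟩ := hq
    refine ⟨g + g', fun a ha => ?_, by rw [add_sub_add_comm]; exact Ideal.add_mem _ hpg hqg⟩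
    obtain ha | ha := Finset.mem_union.1 (support_add ha)
    · exact hg a ha
    · exact hg' a ha

/-- Reduce `f` modulo the ideal to a combination of chain monomials; if all the maps kill it, it is
0. -/
theorem mem_intersectionIdeal_iff (hn : 1 ≤ n) {f : MvPolynomial (UpperPos n) ℂ} :
    f ∈ intersectionIdeal n ↔ ∀ c < n, rankOneHom n c f = 0 := by
  refine ⟨fun hf c hc => rankOneHom_eq_zero_of_mem hn hc hf, fun hf => ?_⟩
  obtain ⟨g, hg, hfg⟩ := exists_sub_mem f
  have : g = 0 := eq_zero_of_support_subset hn (fun c hc => by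
    have := rankOneHom_eq_zero_of_mem hn hc hfg
    rwa [map_sub, hf c hc, zero_sub, neg_eq_zero] at this) hg
  rwa [this, sub_zero] at hfg

theorem isRadical_intersectionIdeal (hn : 1 ≤ n) : (intersectionIdeal n).IsRadical := by
  rintro f ⟨k, hk⟩
  rw [mem_intersectionIdeal_iff hn] at hk ⊢
  intro c hc
  have := hk c hc
  rw [map_pow] at this
  exact eq_zero_of_pow_eq_zero this

theorem monomial_mem_initialIdeal_of_crossing {p q : UpperPos n} (h₁ : (p.1.1 : ℕ) < q.1.1)
    (h₂ : (p.1.2 : ℕ) < q.1.2) :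
    (X p * X q : MvPolynomial (UpperPos n) ℂ) ∈
      initialIdeal (upperLabel n) (intersectionIdeal n) := by
  classical
  have hX : ∀ s t : UpperPos n, (X s * X t : MvPolynomial (UpperPos n) ℂ) =
      monomial (Finsupp.single s 1 + Finsupp.single t 1) 1 := by
    intro s t
    rw [X, X, monomial_mul, one_mul]
  refine Ideal.subset_span ?_
  by_cases h : (q.1.1 : ℕ) < p.1.2
  · have f1 : p.len = (p.1.2 : ℕ) - p.1.1 := rfl
    have f2 : q.len = (q.1.2 : ℕ) - q.1.1 := rfl
    have f3 : (hull p q h₁).len = (q.1.2 : ℕ) - p.1.1 := rfl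
    have f4 : (overlap p q h).len = (p.1.2 : ℕ) - q.1.1 := rfl
    have hp : p.len < (hull p q h₁).len := by omega
    have hq : q.len < (hull p q h₁).len := by omega
    have hov : (overlap p q h).len < (hull p q h₁).len := by omega
    have hhull : (Finsupp.single p 1 + Finsupp.single q 1 : UpperPos n →₀ ℕ) (hull p q h₁) = 0 := by
      have hp' : p ≠ hull p q h₁ := fun h => hp.ne (congrArg len h)
      have hq' : q ≠ hull p q h₁ := fun h => hq.ne (congrArg len h)
      simp [hp', hq']
    have hne : Finsupp.single p 1 + Finsupp.single q 1 ≠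
        Finsupp.single (hull p q h₁) 1 + Finsupp.single (overlap p q h) 1 := by
      intro heq
      rw [heq] at hhull
      simp at hhull
    refine ⟨_, X_mul_X_sub_mem_of_crossing h₁ h, _, ⟨?_, ?_⟩, hX p q⟩
    · rw [hX, hX, mem_support_iff, coeff_sub, coeff_monomial, coeff_monomial, if_pos rfl,
        if_neg hne.symm]
      simp
    · intro b hb hba
      rw [hX, hX] at hb
      obtain hb | hb := Finset.mem_union.1 (support_sub _ _ _ hb)
      · exact absurd (Finset.mem_singleton.1 (support_monomial_subset hb)) hba
      · rw [Finset.mem_singleton.1 (support_monomial_subset hb)]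
        -- The hull is the longest of the four intervals, so it is the last variable that occurs,
        -- and only in the other monomial.
        refine Or.inr ⟨by simp, hull p q h₁, by rw [hhull]; simp, fun t ht => ?_⟩
        have hne' : ∀ s : UpperPos n, upperLabel n s ≤ upperLabel n (hull p q h₁) → s ≠ t := by
          rintro s hs rfl
          exact absurd ht (not_lt.2 hs)
        have h5 := hne' p (upperLabel_lt_of_len_lt hp).le
        have h6 := hne' q (upperLabel_lt_of_len_lt hq).le
        have h7 := hne' _ le_rfl
        have h8 := hne' _ (upperLabel_lt_of_len_lt hov).le
        simp [h5, h6, h7, h8]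
  · refine ⟨_, X_mul_X_mem_of_disjoint (not_lt.1 h), _, ⟨?_, ?_⟩, hX p q⟩
    · rw [hX, support_monomial, if_neg one_ne_zero]
      exact Finset.mem_singleton_self _
    · intro b hb hne
      rw [hX] at hb
      exact absurd (Finset.mem_singleton.1 (support_monomial_subset hb)) hne

theorem initialIdeal_intersectionIdeal (hn : 1 ≤ n) :
    initialIdeal (upperLabel n) (intersectionIdeal n) = stanleyReisnerIdeal (intervalComplex n) := by
  classical
  apply le_antisymm
  · refine Ideal.span_le.2 ?_
    rintro _ ⟨f, hf, a, ⟨ha, hlead⟩, rfl⟩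
    have hΔ : a.support ∉ intervalComplex n := by
      intro hΔ
      obtain ⟨b, hb, hba, hm⟩ := exists_margin_eq hn ((mem_intersectionIdeal_iff hn).1 hf) ha hΔ
      exact not_degRevLexGT_of_margin_eq hΔ hm (hlead b hb hba)
    refine Ideal.mem_of_dvd _ ?_ (Ideal.subset_span ⟨a.support, hΔ, rfl⟩)
    rw [monomial_eq, C_1, one_mul, Finsupp.prod]
    exact Finset.prod_dvd_prod_of_dvd _ _ fun p hp =>
      dvd_pow_self _ (Finsupp.mem_support_iff.1 hp)
  · refine Ideal.span_le.2 ?_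
    rintro _ ⟨S, hS, rfl⟩
    obtain ⟨p, hp, q, hq, h1, h2⟩ := exists_crossing_of_notMem hS
    have hne : p ≠ q := by
      rintro rfl
      omega
    refine Ideal.mem_of_dvd _ ?_ (monomial_mem_initialIdeal_of_crossing h1 h2)
    rw [← Finset.prod_pair hne (f := fun s => (X s : MvPolynomial (UpperPos n) ℂ))]
    exact Finset.prod_dvd_prod_of_subset _ _ _ (Finset.insert_subset hp
      (Finset.singleton_subset_iff.2 hq))

end Ideals

theorem theorem1p4 (n : ℕ) (hn : 1 ≤ n) :
    IsReduced (IntersectionRing n) ∧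
    IsCohenMacaulayRing (IntersectionRing n) ∧
    initialIdeal (upperLabel n) (intersectionIdeal n) = stanleyReisnerIdeal (intervalComplex n) ∧
    ∃ Ps : List (List (UpperPos n)),
      (∀ P, P ∈ Ps ↔ IsLatticePath P) ∧
      Ps.Pairwise PathPrecedes ∧
      IsShelling (intervalComplex n) (Ps.map List.toFinset) := by
  refine ⟨(Ideal.isRadical_iff_quotient_reduced _).1 (isRadical_intersectionIdeal hn), ?_,
    initialIdeal_intersectionIdeal hn, latticePaths n, fun P => mem_latticePaths,
    pairwise_latticePaths, isShelling_latticePaths hn⟩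
  obtain ⟨D⟩ := (isShelling_latticePaths hn).exists_rankedPartition (ρ := UpperPos.rank)
    fun F hF => bijOn_rank hn hF
  exact D.isCohenMacaulayRing_quotient _ _ straightens_intersectionIdeal fun f hf hΔ =>
    eq_zero_of_support_subset hn ((mem_intersectionIdeal_iff hn).1 hf) hΔ
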